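/- Let $\lambda=(\lambda_1\ge\lambda_2\ge\cdots)$ be a partition with conjugate $\lambda'$, and put $|\lambda|=\sum_i\lambda_i$, $n(\lambda)=\sum_{i\ge1}(i-1)\lambda_i$. For a box $x=(i,j)$ of the diagram of a partition $\mu$ let $c(x)=j-i$ be its content and $h(x)=\mu_i-j+\mu'_j-i+1$ its hook length. For an integer $N\ge 0$ the generalized $q$-Gaussian coefficient is $$\left[{N\atop \mu}\right]_q=\prod_{x\in\mu}\frac{1-q^{N-c(x)}}{1-q^{h(x)}},\qquad\text{so that}\qquad \left[{N\atop \lambda'}\right]_q=\prod_{x\in\lambda}\frac{1-q^{N+c(x)}}{1-q^{h(x)}} .$$ Then $\left[{N\atop\lambda'}\right]_q$ is a polynomial in $q$ with integer coefficients; writing it as $\sum_{i=0}^d a_iq^i$ with $d$ its degree ($d=0$ if it is zero), it is symmetric, i.e. $a_i=a_{d-i}$ for $0\le i\le d$, and unimodal, i.e. $a_0\le\cdots\le a_m\ge a_{m+1}\ge\cdots\ge a_d$ for some $m$. If $\lambda$ has at most $N$ nonzero parts (otherwise the coefficient is $0$), it is nonzero, its degree is $(N-1)|\lambda|-2n(\lambda)$,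 and consequently $q^{n(\lambda)}\left[{N\atop\lambda'}\right]_q$ has degree $(N-1)|\lambda|-n(\lambda)$. -/

import Mathlib

namespace GenGauss

/-- `n(lam) = ∑_{i ≥ 1} (i - 1) lam_i`; rows are numbered from `0` here. -/
def nStat (lam : YoungDiagram) : ℕ :=
  ∑ i ∈ Finset.range (lam.colLen 0), i * lam.rowLen i

/-- The content `j - i` of the box in row `i` and column `j`. -/
def content (x : ℕ × ℕ) : ℤ := (x.2 : ℤ) - (x.1 : ℤ)

/-- The hook length (arm + leg + 1) of a box `x` of the diagram. The subtractions are exact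
when `x` belongs to the diagram. -/
def hookLength (lam : YoungDiagram) (x : ℕ × ℕ) : ℕ :=
  (lam.rowLen x.1 - (x.2 + 1)) + (lam.colLen x.2 - (x.1 + 1)) + 1

/-- The generalized Gaussian coefficient, with lower entry an arbitrary partition `mu`:
`∏_{x ∈ mu} (1 - q ^ (N - c(x))) / (1 - q ^ h(x))`, a rational function of `q` with integer
coefficients. For `mu` the conjugate of `lam` it is
`∏_{x ∈ lam} (1 - q ^ (N + c(x))) / (1 - q ^ h(x))`. -/
noncomputable def gaussCoeff (N : ℕ) (mu : YoungDiagram) : RatFunc ℤ :=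
  ∏ x ∈ mu.cells,
    (1 - (RatFunc.X : RatFunc ℤ) ^ ((N : ℤ) - content x)) /
      (1 - (RatFunc.X : RatFunc ℤ) ^ hookLength mu x)

/-- The coefficients `a_0, …, a_d` (`d` the degree) satisfy `a_i = a_{d - i}`. -/
def IsSymmetric (P : Polynomial ℤ) : Prop :=
  ∀ i ≤ P.natDegree, P.coeff i = P.coeff (P.natDegree - i)

/-- The coefficients satisfy `a_0 ≤ ⋯ ≤ a_m ≥ ⋯ ≥ a_d` for some `m`, `d` being the degree. -/
def IsUnimodal (P : Polynomial ℤ) : Prop :=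
  ∃ m ≤ P.natDegree,
    (∀ i < m, P.coeff i ≤ P.coeff (i + 1)) ∧
    (∀ i, m ≤ i → i < P.natDegree → P.coeff (i + 1) ≤ P.coeff i)

end GenGauss

/-!
The coefficient is a generating function of Gelfand–Tsetlin patterns. Let `lam` have at most `N`
rows. On the vector space whose basis is the set of patterns with bottom row `lam`, the
Gelfand–Tsetlin formulas for `gl_N` define the principal `sl₂`-triple; its Cartan element multiplies
a pattern by twice its degree plus a constant. The representation theory of `sl₂` then says that the
number of patterns of degree `d` increases with `d` while this weight is negative and decreases
while it is positive, which is unimodality.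

On the other hand, removing the bottom row of a pattern is the branching rule for the Schur function
at `1, q, …, q ^ (N - 1)`. For a Vandermonde determinant this rule is subtraction of adjacent rows,
so by induction the generating function is the product of
`(1 - q ^ (l_i - l_k)) / (1 - q ^ (k - i))` over `i < k`, where `l_i = lam_i - i`. The hook lengths
of row `i` and the differences `l_i - l_k` together are the numbers `1, …, lam_i + N - 1 - i`, which
turns this quotient into the product over the boxes. Finally, each factor `1 - q ^ k` is
antipalindromic, hence the symmetry, and the degree is the sum of the `N + c(x) - h(x)`.
-/

namespace GenGauss

section Residues

variable {ι K : Type*} [DecidableEq ι] [Field K]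

theorem sum_residues_of_injOn (s : Finset ι) (v n : ι → K) (hv : Set.InjOn v s) :
    ∑ i ∈ s, (∏ j ∈ s, (v i - n j)) / ∏ j ∈ s.erase i, (v i - v j) =
      ∑ i ∈ s, v i - ∑ i ∈ s, n i := by
  rcases s.eq_empty_or_nonempty with rfl | hs
  · simp
  have hdeg : (Lagrange.nodal s n - Lagrange.nodal s v).degree < s.card := by
    have h := Polynomial.degree_sub_lt_left
      (p := Lagrange.nodal s n) (q := Lagrange.nodal s v)
      (by rw [Lagrange.degree_nodal, Lagrange.degree_nodal]) Lagrange.nodal_ne_zero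
      (by rw [Lagrange.nodal_monic.leadingCoeff, Lagrange.nodal_monic.leadingCoeff])
    rwa [Lagrange.degree_nodal] at h
  have hcoeff := Lagrange.coeff_eq_sum hv hdeg
  rw [Polynomial.coeff_sub, Lagrange.nodal_eq, Lagrange.nodal_eq,
    Polynomial.prod_X_sub_C_coeff_card_pred _ _ hs.card_pos,
    Polynomial.prod_X_sub_C_coeff_card_pred _ _ hs.card_pos, neg_sub_neg] at hcoeff
  rw [hcoeff]
  refine Finset.sum_congr rfl fun i hi => ?_
  rw [← Lagrange.nodal_eq, ← Lagrange.nodal_eq, Polynomial.eval_sub, Lagrange.eval_nodal,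
    Lagrange.eval_nodal_at_node hi, sub_zero]

variable [Fintype ι]

theorem prod_div_prod_erase_eq_of_cancel {s : Finset ι} {v n : ι → K} {i : ι} (hi : i ∈ s)
    (hn : ∀ j ∉ s, n j = v j) (hv : ∀ j ∉ s, v i ≠ v j) :
    (∏ j, (v i - n j)) / ∏ j ∈ Finset.univ.erase i, (v i - v j) =
      (∏ j ∈ s, (v i - n j)) / ∏ j ∈ s.erase i, (v i - v j) := by
  have hnum : ∏ j ∈ sᶜ, (v i - n j) = ∏ j ∈ sᶜ, (v i - v j) :=
    Finset.prod_congr rfl fun j hj => by rw [hn j (Finset.mem_compl.1 hj)]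
  have hunion : Finset.univ.erase i = s.erase i ∪ sᶜ := by
    rw [← Finset.union_compl s, Finset.erase_union_distrib,
      Finset.erase_eq_of_notMem (Finset.notMem_compl.2 hi)]
  have hdisj : Disjoint (s.erase i) sᶜ :=
    Finset.disjoint_of_subset_left (Finset.erase_subset i s) disjoint_compl_right
  have hne : ∏ j ∈ sᶜ, (v i - v j) ≠ 0 :=
    Finset.prod_ne_zero_iff.2 fun j hj => sub_ne_zero.2 (hv j (Finset.mem_compl.1 hj))
  rw [← Finset.prod_mul_prod_compl s, hnum, hunion, Finset.prod_union hdisj,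
    mul_div_mul_right _ _ hne]

-- A coinciding node cancels against a numerator zero; its summand then vanishes, as `x / 0 = 0`.
theorem sum_residues (v n : ι → K) (h : ∀ i j, i ≠ j → v i = v j → n i = v i) :
    ∑ i, (∏ j, (v i - n j)) / ∏ j ∈ Finset.univ.erase i, (v i - v j) =
      ∑ i, v i - ∑ i, n i := by
  classical
  let s : Finset ι := {i | ∀ j, v i = v j → i = j}
  have hs : ∀ i, i ∈ s ↔ ∀ j, v i = v j → i = j := by simp [s]
  have hcancel : ∀ i ∉ s, n i = v i := by
    intro i hi
    rw [hs] at hi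
    push Not at hi
    obtain ⟨j, hj, hij⟩ := hi
    exact h i j hij hj
  have hinj : Set.InjOn v s := fun i hi j _ hij => (hs i).1 hi j hij
  have hsep : ∀ i ∈ s, ∀ j ∉ s, v i ≠ v j := fun i hi j hj hij =>
    hj ((hs i).1 hi j hij ▸ hi)
  have hzero : ∀ i ∉ s, (∏ j, (v i - n j)) / ∏ j ∈ Finset.univ.erase i, (v i - v j) = 0 :=
    fun i hi => by
      rw [Finset.prod_eq_zero (Finset.mem_univ i) (by rw [hcancel i hi, sub_self]), zero_div]
  calc
    _ = ∑ i ∈ s, (∏ j, (v i - n j)) / ∏ j ∈ Finset.univ.erase i, (v i - v j) :=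
      (Finset.sum_subset (Finset.subset_univ s) fun i _ hi => hzero i hi).symm
    _ = ∑ i ∈ s, (∏ j ∈ s, (v i - n j)) / ∏ j ∈ s.erase i, (v i - v j) :=
      Finset.sum_congr rfl fun i hi => prod_div_prod_erase_eq_of_cancel hi hcancel (hsep i hi)
    _ = ∑ i ∈ s, (v i - n i) := by
      rw [sum_residues_of_injOn s v n hinj, Finset.sum_sub_distrib]
    _ = ∑ i, (v i - n i) :=
      Finset.sum_subset (Finset.subset_univ s) fun i _ hi => by rw [hcancel i hi, sub_self]
    _ = ∑ i, v i - ∑ i, n i := Finset.sum_sub_distrib _ _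

theorem prod_erase_inl_elim_sub_one (l : ι → K) (i : ι) :
    ∏ a ∈ Finset.univ.erase (Sum.inl i), (l i - Sum.elim l (l · - 1) a) =
      (∏ j ∈ Finset.univ.erase i, (l i - l j)) *
        ∏ j ∈ Finset.univ.erase i, (l i + 1 - l j) := by
  have herase : Finset.univ.erase (Sum.inl i : ι ⊕ ι) =
      (Finset.univ.erase i).disjSum Finset.univ := by
    ext (a | a) <;> simp
  rw [herase, Finset.prod_disjSum, ← Finset.mul_prod_erase Finset.univ _ (Finset.mem_univ i)]
  simp only [Sum.elim_inl, Sum.elim_inr, sub_sub_cancel, one_mul, sub_sub_eq_add_sub]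

theorem prod_erase_inr_elim_sub_one (l : ι → K) (i : ι) :
    ∏ a ∈ Finset.univ.erase (Sum.inr i), (l i - 1 - Sum.elim l (l · - 1) a) =
      -((∏ j ∈ Finset.univ.erase i, (l i - 1 - l j)) *
        ∏ j ∈ Finset.univ.erase i, (l i - l j)) := by
  have herase : Finset.univ.erase (Sum.inr i : ι ⊕ ι) =
      Finset.univ.disjSum (Finset.univ.erase i) := by
    ext (a | a) <;> simp
  rw [herase, Finset.prod_disjSum, ← Finset.mul_prod_erase Finset.univ _ (Finset.mem_univ i)]
  simp only [Sum.elim_inl, Sum.elim_inr, sub_sub_sub_cancel_right, sub_sub_cancel_left,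
    neg_mul, one_mul]

theorem sum_residues_shift {l : ι → K} (hl : Function.Injective l) (n : ι ⊕ ι → K)
    (h : ∀ i j, l i = l j - 1 → n (Sum.inl i) = l i ∧ n (Sum.inr j) = l j - 1) :
    ∑ i, ((∏ a, (l i - n a)) / ((∏ j ∈ Finset.univ.erase i, (l i - l j)) *
        ∏ j ∈ Finset.univ.erase i, (l i + 1 - l j)) -
      (∏ a, (l i - 1 - n a)) / ((∏ j ∈ Finset.univ.erase i, (l i - 1 - l j)) *
        ∏ j ∈ Finset.univ.erase i, (l i - l j))) =
      2 * ∑ i, l i - Fintype.card ι - ∑ a, n a := by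
  have key := sum_residues (Sum.elim l (l · - 1)) n (by
    rintro (i | i) (j | j) hij hv
    · exact absurd (hl hv) (by simpa using hij)
    · exact (h i j hv).1
    · exact (h j i hv.symm).2
    · exact absurd (hl (sub_left_injective hv)) (by simpa using hij))
  simp only [Fintype.sum_sum_type, Sum.elim_inl, Sum.elim_inr, prod_erase_inl_elim_sub_one,
    prod_erase_inr_elim_sub_one, div_neg, Finset.sum_neg_distrib, Finset.sum_sub_distrib,
    Finset.sum_const, Finset.card_univ, nsmul_eq_mul, mul_one] at key
  rw [Finset.sum_sub_distrib, sub_eq_add_neg, key, Fintype.sum_sum_type]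
  ring

end Residues

section SlTwo

open Module LieModule

variable {K L M : Type*} [Field K] [LieRing L] [LieAlgebra K L] [AddCommGroup M] [Module K M]
  [LieRingModule L M] [LieModule K L M] {h e f : L}

theorem eigenspace_toEnd_neg (h : L) (μ : K) :
    End.eigenspace (toEnd K L M (-h)) (-μ) = End.eigenspace (toEnd K L M h) μ := by
  ext m
  rw [End.mem_eigenspace_iff, End.mem_eigenspace_iff, toEnd_apply_apply, toEnd_apply_apply, neg_lie,
    neg_smul, neg_inj]

variable [LinearOrder K] [IsStrictOrderedRing K] [FiniteDimensional K M]

theorem finrank_eigenspace_le_add_two_of_isSl2Triple (t : IsSl2Triple h e f) {μ : K} (hμ : μ < 0) :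
    finrank K (End.eigenspace (toEnd K L M h) μ) ≤
      finrank K (End.eigenspace (toEnd K L M h) (μ + 2)) := by
  have hmaps : ∀ m ∈ End.eigenspace (toEnd K L M h) μ,
      toEnd K L M e m ∈ End.eigenspace (toEnd K L M h) (μ + 2) := by
    intro m hm
    rw [End.mem_eigenspace_iff, toEnd_apply_apply] at hm ⊢
    rw [toEnd_apply_apply, leibniz_lie, t.lie_h_e_smul K, hm, lie_smul, smul_lie, add_smul,
      add_comm]
  refine LinearMap.finrank_le_finrank_of_injective (f := (toEnd K L M e).restrict hmaps) ?_
  rw [injective_iff_map_eq_zero]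
  rintro ⟨m, hm⟩ hem
  by_contra hne
  have hprim : t.HasPrimitiveVectorWith m μ :=
    { ne_zero := fun h0 => hne (Subtype.ext h0)
      lie_h := End.mem_eigenspace_iff.1 hm
      lie_e := congrArg Subtype.val hem }
  obtain ⟨n, rfl⟩ := hprim.exists_nat
  exact absurd hμ (Nat.cast_nonneg n).not_gt

theorem finrank_eigenspace_le_sub_two_of_isSl2Triple (t : IsSl2Triple h e f) {μ : K} (hμ : 0 < μ) :
    finrank K (End.eigenspace (toEnd K L M h) μ) ≤
      finrank K (End.eigenspace (toEnd K L M h) (μ - 2)) := by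
  rw [← eigenspace_toEnd_neg h μ, ← eigenspace_toEnd_neg h (μ - 2), neg_sub', sub_neg_eq_add]
  exact finrank_eigenspace_le_add_two_of_isSl2Triple t.symm (neg_lt_zero.2 hμ)

end SlTwo

section Patterns

/-- A position in an infinite triangular array, whose row `k` has the `k` entries `⟨k, i⟩`. -/
abbrev Box := (k : ℕ) × Fin k

/-- The triangular array with entry `1` in the box `x` and `0` elsewhere, used to raise or lower a
single entry of a Gelfand–Tsetlin pattern. -/
def unitBox (x : Box) : Box → ℤ := Pi.single x 1

/-- Gelfand–Tsetlin patterns with `N` rows and bottom row `L`, the basis of the representation of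
`gl_N`. They are written in strict coordinates: the entry `i` of each row has been decreased by
`i`, which makes the rows strictly decreasing, and the entries below row `N` are set to `0`. -/
structure IsPattern (N : ℕ) (L : Fin N → ℤ) (T : Box → ℤ) : Prop where
  bottom : ∀ i, T ⟨N, i⟩ = L i
  zero : ∀ x : Box, N < x.1 → T x = 0
  lt : ∀ k < N, ∀ i : Fin k, T ⟨k + 1, i.succ⟩ < T ⟨k, i⟩
  le : ∀ k < N, ∀ i : Fin k, T ⟨k, i⟩ ≤ T ⟨k + 1, i.castSucc⟩

variable {N : ℕ} {L : Fin N → ℤ} {T : Box → ℤ} {x y : Box}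

theorem add_unitBox_apply_self (T : Box → ℤ) (x : Box) : (T + unitBox x) x = T x + 1 := by
  rw [Pi.add_apply, unitBox, Pi.single_eq_same]

theorem sub_unitBox_apply_self (T : Box → ℤ) (x : Box) : (T - unitBox x) x = T x - 1 := by
  rw [Pi.sub_apply, unitBox, Pi.single_eq_same]

theorem add_unitBox_apply_of_ne (T : Box → ℤ) (h : y ≠ x) : (T + unitBox x) y = T y := by
  rw [Pi.add_apply, unitBox, Pi.single_eq_of_ne h, add_zero]

theorem sub_unitBox_apply_of_ne (T : Box → ℤ) (h : y ≠ x) : (T - unitBox x) y = T y := by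
  rw [Pi.sub_apply, unitBox, Pi.single_eq_of_ne h, sub_zero]

theorem le_add_unitBox (T : Box → ℤ) (x : Box) : T ≤ T + unitBox x :=
  le_add_of_nonneg_right (Pi.single_nonneg.2 zero_le_one)

theorem sub_unitBox_le (T : Box → ℤ) (x : Box) : T - unitBox x ≤ T :=
  sub_le_self T (Pi.single_nonneg.2 zero_le_one)

theorem Box.ne_of_row_ne (h : x.1 ≠ y.1) : x ≠ y := fun hxy => h (congrArg Sigma.fst hxy)

theorem Box.mk_ne_mk {k : ℕ} {i j : Fin k} (h : i ≠ j) : (⟨k, i⟩ : Box) ≠ ⟨k, j⟩ :=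
  fun hij => h (sigma_mk_injective hij)

theorem IsPattern.strictAnti (hT : IsPattern N L T) {k : ℕ} (hk : k < N) :
    StrictAnti fun i : Fin (k + 1) => T ⟨k + 1, i⟩ :=
  Fin.strictAnti_iff_succ_lt.2 fun i => (hT.lt k hk i).trans_le (hT.le k hk i)

theorem IsPattern.add_unitBox (hT : IsPattern N L T) (hx : x.1 < N)
    (hle : T x < T ⟨x.1 + 1, x.2.castSucc⟩)
    (hlt : ∀ k (i : Fin k), ⟨k + 1, i.succ⟩ = x → T x + 1 < T ⟨k, i⟩) :
    IsPattern N L (T + unitBox x) where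
  bottom i := by rw [add_unitBox_apply_of_ne T (Box.ne_of_row_ne hx.ne'), hT.bottom]
  zero z hz := by rw [add_unitBox_apply_of_ne T (Box.ne_of_row_ne (by omega)), hT.zero z hz]
  lt k hk i := by
    refine lt_of_lt_of_le ?_ (le_add_unitBox T x _)
    by_cases h : ⟨k + 1, i.succ⟩ = x
    · rw [h, add_unitBox_apply_self]
      exact hlt k i h
    · rw [add_unitBox_apply_of_ne T h]
      exact hT.lt k hk i
  le k hk i := by
    by_cases h : ⟨k, i⟩ = x
    · subst h
      rw [add_unitBox_apply_self]
      exact (Int.add_one_le_of_lt hle).trans (le_add_unitBox T _ _)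
    · rw [add_unitBox_apply_of_ne T h]
      exact (hT.le k hk i).trans (le_add_unitBox T _ _)

theorem IsPattern.sub_unitBox (hT : IsPattern N L T) (hx : x.1 < N)
    (hlt : T ⟨x.1 + 1, x.2.succ⟩ + 1 < T x)
    (hle : ∀ k (i : Fin k), ⟨k + 1, i.castSucc⟩ = x → T ⟨k, i⟩ < T x) :
    IsPattern N L (T - unitBox x) where
  bottom i := by rw [sub_unitBox_apply_of_ne T (Box.ne_of_row_ne hx.ne'), hT.bottom]
  zero z hz := by rw [sub_unitBox_apply_of_ne T (Box.ne_of_row_ne (by omega)), hT.zero z hz]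
  lt k hk i := by
    by_cases h : ⟨k, i⟩ = x
    · subst h
      rw [sub_unitBox_apply_self]
      exact (sub_unitBox_le T _ _).trans_lt (lt_sub_iff_add_lt.2 hlt)
    · rw [sub_unitBox_apply_of_ne T h]
      exact (sub_unitBox_le T _ _).trans_lt (hT.lt k hk i)
  le k hk i := by
    refine (sub_unitBox_le T x _).trans ?_
    by_cases h : ⟨k + 1, i.castSucc⟩ = x
    · rw [h, sub_unitBox_apply_self]
      exact Int.le_sub_one_of_lt (hle k i h)
    · rw [sub_unitBox_apply_of_ne T h]
      exact hT.le k hk i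

theorem IsPattern.add_unitBox_of_add_sub (hT : IsPattern N L T)
    (h : IsPattern N L (T + unitBox x - unitBox y)) (hx : x.1 < N) (hxy : x ≠ y) :
    IsPattern N L (T + unitBox x) := by
  have hTx : (T + unitBox x - unitBox y) x = T x + 1 := by
    rw [sub_unitBox_apply_of_ne _ hxy, add_unitBox_apply_self]
  have hle : ∀ z ≠ x, (T + unitBox x - unitBox y) z ≤ T z := fun z hz =>
    (sub_unitBox_le _ y z).trans_eq (add_unitBox_apply_of_ne T hz)
  refine hT.add_unitBox hx ?_ fun k i hi => ?_
  · have hle' : (T + unitBox x - unitBox y) x ≤ _ := h.le x.1 hx x.2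
    have := hle ⟨x.1 + 1, x.2.castSucc⟩ (Box.ne_of_row_ne (by simp))
    omega
  · have hlt := h.lt k (by subst hi; exact k.lt_succ_self.trans hx) i
    have := hle ⟨k, i⟩ (by subst hi; exact Box.ne_of_row_ne (by simp))
    rw [hi] at hlt
    omega

theorem IsPattern.sub_unitBox_of_add_sub (hT : IsPattern N L T)
    (h : IsPattern N L (T + unitBox x - unitBox y)) (hy : y.1 < N) (hxy : x ≠ y) :
    IsPattern N L (T - unitBox y) := by
  have hTy : (T + unitBox x - unitBox y) y = T y - 1 := by
    rw [sub_unitBox_apply_self, add_unitBox_apply_of_ne T hxy.symm]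
  have hle : ∀ z ≠ y, T z ≤ (T + unitBox x - unitBox y) z := fun z hz =>
    (le_add_unitBox T x z).trans_eq (sub_unitBox_apply_of_ne _ hz).symm
  refine hT.sub_unitBox hy ?_ fun k i hi => ?_
  · have hlt : _ < (T + unitBox x - unitBox y) y := h.lt y.1 hy y.2
    have := hle ⟨y.1 + 1, y.2.succ⟩ (Box.ne_of_row_ne (by simp))
    omega
  · have hle' := h.le k (by subst hi; exact k.lt_succ_self.trans hy) i
    have := hle ⟨k, i⟩ (by subst hi; exact Box.ne_of_row_ne (by simp))
    rw [hi] at hle'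
    omega

end Patterns

section Coefficients

/-- The product of the differences between `u` and some entries of row `k` of the array `T`; the
Gelfand–Tsetlin matrix coefficients are quotients of such products. -/
def rowProd {k : ℕ} (s : Finset (Fin k)) (T : Box → ℤ) (u : ℚ) : ℚ := ∏ j ∈ s, (u - T ⟨k, j⟩)

/-- The Gelfand–Tsetlin coefficient of `T + unitBox x` in the raising operator applied to `T`. -/
def raiseCoeff (x : Box) (T : Box → ℤ) : ℚ :=
  -rowProd (Finset.univ : Finset (Fin (x.1 + 1))) T (T x) /
    rowProd (Finset.univ.erase x.2) T (T x)

/-- The Gelfand–Tsetlin coefficient of `T - unitBox x` in the lowering operator applied to `T`. The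
subtraction `x.1 - 1` is exact, since row `0` is empty. -/
def lowerCoeff (x : Box) (T : Box → ℤ) : ℚ :=
  rowProd (Finset.univ : Finset (Fin (x.1 - 1))) T (T x) / rowProd (Finset.univ.erase x.2) T (T x)

variable {T : Box → ℤ} {x y : Box} {k : ℕ}

theorem rowProd_eq_mul_erase {s : Finset (Fin k)} {j : Fin k} (hj : j ∈ s) (T : Box → ℤ) (u : ℚ) :
    rowProd s T u = (u - T ⟨k, j⟩) * rowProd (s.erase j) T u :=
  (Finset.mul_prod_erase s (fun j => u - (T ⟨k, j⟩ : ℚ)) hj).symm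

theorem rowProd_eq_zero {s : Finset (Fin k)} {j : Fin k} (hj : j ∈ s) {u : ℚ}
    (h : u = T ⟨k, j⟩) : rowProd s T u = 0 :=
  Finset.prod_eq_zero hj (sub_eq_zero.2 h)

theorem rowProd_add_unitBox {s : Finset (Fin k)} (h : ∀ j ∈ s, ⟨k, j⟩ ≠ x) (T : Box → ℤ) (u : ℚ) :
    rowProd s (T + unitBox x) u = rowProd s T u :=
  Finset.prod_congr rfl fun j hj => by rw [add_unitBox_apply_of_ne T (h j hj)]

theorem rowProd_sub_unitBox {s : Finset (Fin k)} (h : ∀ j ∈ s, ⟨k, j⟩ ≠ x) (T : Box → ℤ) (u : ℚ) :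
    rowProd s (T - unitBox x) u = rowProd s T u :=
  Finset.prod_congr rfl fun j hj => by rw [sub_unitBox_apply_of_ne T (h j hj)]

theorem rowProd_erase_add_unitBox (s : Finset (Fin k)) (i : Fin k) (T : Box → ℤ) (u : ℚ) :
    rowProd (s.erase i) (T + unitBox ⟨k, i⟩) u = rowProd (s.erase i) T u :=
  rowProd_add_unitBox (fun _ hj => Box.mk_ne_mk (Finset.ne_of_mem_erase hj)) T u

theorem rowProd_erase_sub_unitBox (s : Finset (Fin k)) (i : Fin k) (T : Box → ℤ) (u : ℚ) :
    rowProd (s.erase i) (T - unitBox ⟨k, i⟩) u = rowProd (s.erase i) T u :=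
  rowProd_sub_unitBox (fun _ hj => Box.mk_ne_mk (Finset.ne_of_mem_erase hj)) T u

theorem rowProd_add_unitBox_of_row_ne (s : Finset (Fin k)) {l : ℕ} {i : Fin l} (h : k ≠ l)
    (T : Box → ℤ) (u : ℚ) : rowProd s (T + unitBox ⟨l, i⟩) u = rowProd s T u :=
  rowProd_add_unitBox (fun _ _ => Box.ne_of_row_ne h) T u

theorem rowProd_sub_unitBox_of_row_ne (s : Finset (Fin k)) {l : ℕ} {i : Fin l} (h : k ≠ l)
    (T : Box → ℤ) (u : ℚ) : rowProd s (T - unitBox ⟨l, i⟩) u = rowProd s T u :=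
  rowProd_sub_unitBox (fun _ _ => Box.ne_of_row_ne h) T u

theorem raiseCoeff_mul_lowerCoeff_comm_same_row {i j : Fin k} (hij : i ≠ j) (T : Box → ℤ) :
    raiseCoeff ⟨k, i⟩ (T - unitBox ⟨k, j⟩) * lowerCoeff ⟨k, j⟩ T =
      lowerCoeff ⟨k, j⟩ (T + unitBox ⟨k, i⟩) * raiseCoeff ⟨k, i⟩ T := by
  have hi : i ∈ Finset.univ.erase j := Finset.mem_erase.2 ⟨hij, Finset.mem_univ i⟩
  have hj : j ∈ Finset.univ.erase i := Finset.mem_erase.2 ⟨hij.symm, Finset.mem_univ j⟩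
  have hrow : k - 1 ≠ k := by have := i.pos; omega
  simp only [raiseCoeff, lowerCoeff, rowProd_eq_mul_erase hi, rowProd_eq_mul_erase hj,
    sub_unitBox_apply_of_ne T (Box.mk_ne_mk hij), add_unitBox_apply_of_ne T (Box.mk_ne_mk hij.symm),
    sub_unitBox_apply_self, add_unitBox_apply_self, rowProd_erase_sub_unitBox,
    rowProd_erase_add_unitBox, rowProd_sub_unitBox_of_row_ne _ k.succ_ne_self,
    rowProd_add_unitBox_of_row_ne _ hrow, div_mul_div_comm]
  push_cast
  ring

theorem raiseCoeff_mul_lowerCoeff_comm_next_row (i : Fin k) (j : Fin (k + 1)) (T : Box → ℤ) :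
    raiseCoeff ⟨k, i⟩ (T - unitBox ⟨k + 1, j⟩) * lowerCoeff ⟨k + 1, j⟩ T =
      lowerCoeff ⟨k + 1, j⟩ (T + unitBox ⟨k, i⟩) * raiseCoeff ⟨k, i⟩ T := by
  have hprev : ∀ S : Box → ℤ, rowProd (Finset.univ : Finset (Fin (k + 1 - 1))) S =
      fun u => (u - S ⟨k, i⟩) * rowProd (Finset.univ.erase i) S u :=
    fun S => funext fun u => rowProd_eq_mul_erase (Finset.mem_univ i) S u
  simp only [raiseCoeff, lowerCoeff, rowProd_eq_mul_erase (Finset.mem_univ j), hprev,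
    sub_unitBox_apply_of_ne T (Box.ne_of_row_ne (x := ⟨k, i⟩) (y := ⟨k + 1, j⟩) (by simp)),
    add_unitBox_apply_of_ne T (Box.ne_of_row_ne (x := ⟨k + 1, j⟩) (y := ⟨k, i⟩) (by simp)),
    sub_unitBox_apply_self, add_unitBox_apply_self, rowProd_erase_sub_unitBox,
    rowProd_erase_add_unitBox, rowProd_sub_unitBox_of_row_ne _ k.lt_succ_self.ne,
    rowProd_add_unitBox_of_row_ne _ k.succ_ne_self, div_mul_div_comm]
  push_cast
  ring

theorem raiseCoeff_mul_lowerCoeff_comm_far_row {l : ℕ} (hsame : l ≠ k) (hnext : l ≠ k + 1)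
    (i : Fin k) (j : Fin l) (T : Box → ℤ) :
    raiseCoeff ⟨k, i⟩ (T - unitBox ⟨l, j⟩) * lowerCoeff ⟨l, j⟩ T =
      lowerCoeff ⟨l, j⟩ (T + unitBox ⟨k, i⟩) * raiseCoeff ⟨k, i⟩ T := by
  have hl : 0 < l := j.pos
  rw [raiseCoeff, lowerCoeff, lowerCoeff, raiseCoeff,
    sub_unitBox_apply_of_ne T (Box.ne_of_row_ne hsame.symm),
    add_unitBox_apply_of_ne T (Box.ne_of_row_ne hsame),
    rowProd_sub_unitBox_of_row_ne _ hnext.symm, rowProd_sub_unitBox_of_row_ne _ hsame.symm,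
    rowProd_add_unitBox_of_row_ne _ (by lia), rowProd_add_unitBox_of_row_ne _ hsame, mul_comm]

theorem raiseCoeff_mul_lowerCoeff_comm (T : Box → ℤ) (hxy : x ≠ y) :
    raiseCoeff x (T - unitBox y) * lowerCoeff y T =
      lowerCoeff y (T + unitBox x) * raiseCoeff x T := by
  obtain ⟨k, i⟩ := x
  obtain ⟨l, j⟩ := y
  by_cases hsame : l = k
  · subst hsame
    exact raiseCoeff_mul_lowerCoeff_comm_same_row (fun h => hxy (by rw [h])) T
  by_cases hnext : l = k + 1
  · subst hnext
    exact raiseCoeff_mul_lowerCoeff_comm_next_row i j T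
  · exact raiseCoeff_mul_lowerCoeff_comm_far_row hsame hnext i j T

theorem raiseCoeff_eq_zero {j : Fin (x.1 + 1)} (h : T x = T ⟨x.1 + 1, j⟩) : raiseCoeff x T = 0 := by
  rw [raiseCoeff, rowProd_eq_zero (Finset.mem_univ j) (by rw [h]), neg_zero, zero_div]

theorem lowerCoeff_eq_zero {i : Fin k} {j : Fin (k + 1)} (h : T ⟨k + 1, j⟩ = T ⟨k, i⟩) :
    lowerCoeff ⟨k + 1, j⟩ T = 0 := by
  rw [lowerCoeff, rowProd_eq_zero (k := k) (Finset.mem_univ i) (by rw [h]), zero_div]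

variable {N : ℕ} {L : Fin N → ℤ}

theorem IsPattern.lower_raise_eq_zero (hT : IsPattern N L T) (hx : x.1 < N)
    (h : ¬ IsPattern N L (T + unitBox x)) :
    lowerCoeff x (T + unitBox x) * raiseCoeff x T = 0 := by
  by_contra hne
  refine h (hT.add_unitBox hx ((hT.le x.1 hx x.2).lt_of_ne fun heq => ?_)
    fun k i hi => lt_of_le_of_ne ?_ fun heq => ?_)
  · exact hne (mul_eq_zero_of_right _ (raiseCoeff_eq_zero heq))
  · rw [← hi]
    exact hT.lt k (by subst hi; exact k.lt_succ_self.trans hx) i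
  · subst hi
    refine hne (mul_eq_zero_of_left (lowerCoeff_eq_zero (i := i) ?_) _)
    rw [add_unitBox_apply_self, add_unitBox_apply_of_ne T (Box.ne_of_row_ne (by simp)), heq]

theorem IsPattern.raise_lower_eq_zero (hT : IsPattern N L T) (hx : x.1 < N)
    (h : ¬ IsPattern N L (T - unitBox x)) :
    raiseCoeff x (T - unitBox x) * lowerCoeff x T = 0 := by
  by_contra hne
  refine h (hT.sub_unitBox hx (lt_of_le_of_ne (hT.lt x.1 hx x.2) fun heq => ?_)
    fun k i hi => lt_of_le_of_ne ?_ fun heq => ?_)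
  · refine hne (mul_eq_zero_of_left (raiseCoeff_eq_zero (j := x.2.succ) ?_) _)
    rw [sub_unitBox_apply_self, sub_unitBox_apply_of_ne T (Box.ne_of_row_ne (by simp))]
    exact sub_eq_of_eq_add heq.symm
  · rw [← hi]
    exact hT.le k (by subst hi; exact k.lt_succ_self.trans hx) i
  · subst hi
    exact hne (mul_eq_zero_of_right _ (lowerCoeff_eq_zero heq.symm))

end Coefficients

section Cartan

/-- The sum of the entries of row `k` of a triangular array, which determines the weight of a
Gelfand–Tsetlin pattern. -/
def rowSum (T : Box → ℤ) (k : ℕ) : ℤ := ∑ i : Fin k, T ⟨k, i⟩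

/-- The sum of the entries above row `N`, which grades the patterns with a given row `N`. -/
def degree (N : ℕ) (T : Box → ℤ) : ℤ := ∑ k ∈ Finset.range N, rowSum T k

/-- The boxes above row `N`, whose entries vary among the patterns with a given row `N`. -/
def boxes (N : ℕ) : Finset Box := (Finset.range N).sigma fun _ => Finset.univ

/-- The diagonal matrix coefficient at `T` of the commutator of raising and lowering at `x`. -/
def diagCoeff (x : Box) (T : Box → ℤ) : ℚ :=
  raiseCoeff x (T - unitBox x) * lowerCoeff x T - lowerCoeff x (T + unitBox x) * raiseCoeff x T

/-- The zeros of the numerators of the diagonal coefficients of row `m + 1`: the entries of row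
`m + 2`, and those of row `m` decreased by `1`. They are indexed like the poles, which are the
entries of row `m + 1` and the same entries decreased by `1`, in such a way that coinciding poles
are cancelled by the zeros with the same index. -/
def numeratorNodes (m : ℕ) (T : Box → ℤ) : Fin (m + 1) ⊕ Fin (m + 1) → ℚ :=
  Sum.elim (fun i => T ⟨m + 2, i.castSucc⟩)
    (Fin.snoc (fun i => (T ⟨m, i⟩ : ℚ) - 1) (T ⟨m + 2, Fin.last _⟩ : ℚ))

/-- The additive constant `κ` in the eigenvalue `2 d + κ` of the Cartan element of the principal
`sl₂` on patterns of degree `d`. -/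
def weightShift (N : ℕ) (L : Fin N → ℤ) : ℚ :=
  -((N : ℚ) - 1) * (∑ i, L i : ℤ) -
    ∑ m ∈ Finset.range (N - 1), ((m : ℚ) + 1) * ((N : ℚ) - (m + 1))

/-- The eigenvalue at the pattern `T` of the Cartan element of the principal `sl₂`. -/
def weight (N : ℕ) (L : Fin N → ℤ) (T : Box → ℤ) : ℚ := 2 * (degree N T : ℚ) + weightShift N L

variable {T : Box → ℤ} {x : Box} {N m : ℕ} {L : Fin N → ℤ}

theorem mem_boxes : x ∈ boxes N ↔ x.1 < N := by simp [boxes]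

theorem diagCoeff_eq (i : Fin (m + 1)) (T : Box → ℤ) :
    diagCoeff ⟨m + 1, i⟩ T =
      (∏ a, ((T ⟨m + 1, i⟩ : ℚ) - numeratorNodes m T a)) /
        (rowProd (Finset.univ.erase i) T (T ⟨m + 1, i⟩) *
          rowProd (Finset.univ.erase i) T (T ⟨m + 1, i⟩ + 1)) -
      (∏ a, ((T ⟨m + 1, i⟩ : ℚ) - 1 - numeratorNodes m T a)) /
        (rowProd (Finset.univ.erase i) T (T ⟨m + 1, i⟩ - 1) *
          rowProd (Finset.univ.erase i) T (T ⟨m + 1, i⟩)) := by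
  have hnodes : ∀ u : ℚ, ∏ a, (u - numeratorNodes m T a) =
      rowProd (Finset.univ : Finset (Fin (m + 2))) T u *
        rowProd (Finset.univ : Finset (Fin m)) T (u + 1) := by
    intro u
    simp only [numeratorNodes, Fintype.prod_sum_type, Sum.elim_inl, Sum.elim_inr,
      Fin.prod_univ_castSucc (fun j : Fin (m + 1) => u - Fin.snoc (α := fun _ => ℚ) _ _ j),
      Fin.snoc_castSucc, Fin.snoc_last, rowProd,
      Fin.prod_univ_castSucc (fun j : Fin (m + 2) => u - (T ⟨m + 2, j⟩ : ℚ)), sub_sub_eq_add_sub]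
    ring
  simp only [diagCoeff, raiseCoeff, lowerCoeff, add_unitBox_apply_self, sub_unitBox_apply_self,
    rowProd_erase_add_unitBox, rowProd_erase_sub_unitBox, hnodes,
    rowProd_sub_unitBox_of_row_ne _ (m + 1).succ_ne_self,
    rowProd_add_unitBox_of_row_ne _ m.lt_succ_self.ne, div_mul_div_comm, sub_add_cancel]
  push_cast
  ring

theorem sum_numeratorNodes (m : ℕ) (T : Box → ℤ) :
    ∑ a, numeratorNodes m T a = rowSum T (m + 2) + rowSum T m - m := by
  simp only [numeratorNodes, rowSum, Fintype.sum_sum_type, Sum.elim_inl, Sum.elim_inr,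
    Fin.sum_univ_castSucc (Fin.snoc (α := fun _ => ℚ) _ _), Fin.snoc_castSucc, Fin.snoc_last,
    Fin.sum_univ_castSucc (n := m + 1) (fun i => T ⟨m + 2, i⟩), Finset.sum_sub_distrib,
    Finset.sum_const, Finset.card_univ, Fintype.card_fin, nsmul_eq_mul]
  push_cast
  ring

theorem exists_castSucc_succ_of_strictAnti {f : Fin (m + 1) → ℤ} (hf : StrictAnti f)
    {i j : Fin (m + 1)} (h : f i = f j - 1) : ∃ k : Fin m, j = k.castSucc ∧ i = k.succ := by
  have hji : j < i := hf.lt_iff_gt.1 (by omega)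
  obtain ⟨k, rfl⟩ := Fin.exists_castSucc_eq.2 (hji.trans_le (Fin.le_last i)).ne
  refine ⟨k, rfl, (Fin.castSucc_lt_iff_succ_le.1 hji).eq_of_not_lt' fun hlt => ?_⟩
  have h₁ := hf (Fin.castSucc_lt_succ (i := k))
  have h₂ := hf hlt
  omega

theorem IsPattern.numeratorNodes_eq (hT : IsPattern N L T) (hm : m + 1 < N) (i j : Fin (m + 1))
    (h : (T ⟨m + 1, i⟩ : ℚ) = T ⟨m + 1, j⟩ - 1) :
    numeratorNodes m T (Sum.inl i) = T ⟨m + 1, i⟩ ∧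
      numeratorNodes m T (Sum.inr j) = T ⟨m + 1, j⟩ - 1 := by
  have hm' : m < N := m.lt_succ_self.trans hm
  obtain ⟨k, rfl, rfl⟩ := exists_castSucc_succ_of_strictAnti (hT.strictAnti hm')
    (by exact_mod_cast h : T ⟨m + 1, i⟩ = T ⟨m + 1, j⟩ - 1)
  have hstep : T ⟨m + 1, k.succ⟩ = T ⟨m + 1, k.castSucc⟩ - 1 := by exact_mod_cast h
  have hnext : T ⟨m + 2, k.succ.castSucc⟩ = T ⟨m + 1, k.succ⟩ := by
    have hlt : T ⟨m + 2, k.succ.castSucc⟩ < T ⟨m + 1, k.castSucc⟩ := hT.lt (m + 1) hm k.castSucc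
    have hle : T ⟨m + 1, k.succ⟩ ≤ T ⟨m + 2, k.succ.castSucc⟩ := hT.le (m + 1) hm k.succ
    omega
  have hprev : T ⟨m, k⟩ = T ⟨m + 1, k.castSucc⟩ := by
    have hlt := hT.lt m hm' k
    have hle := hT.le m hm' k
    omega
  simp only [numeratorNodes, Sum.elim_inl, Sum.elim_inr, Fin.snoc_castSucc, hnext, hprev, and_self]

theorem IsPattern.sum_diagCoeff (hT : IsPattern N L T) (hm : m + 1 < N) :
    ∑ i : Fin (m + 1), diagCoeff ⟨m + 1, i⟩ T =
      2 * (rowSum T (m + 1) : ℚ) - rowSum T (m + 2) - rowSum T m - 1 := by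
  have hinj : Function.Injective fun i : Fin (m + 1) => (T ⟨m + 1, i⟩ : ℚ) :=
    Int.cast_injective.comp (hT.strictAnti (m.lt_succ_self.trans hm)).injective
  have hres := sum_residues_shift hinj (numeratorNodes m T) (hT.numeratorNodes_eq hm)
  rw [sum_numeratorNodes, Fintype.card_fin] at hres
  simp only [diagCoeff_eq, rowProd]
  rw [hres, show (rowSum T (m + 1) : ℚ) = ∑ i : Fin (m + 1), (T ⟨m + 1, i⟩ : ℚ) by
    rw [rowSum, Int.cast_sum]]
  push_cast
  ring

-- Two summations by parts, with weights that vanish at `0` and at `B = M + 1`.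
theorem sum_mul_secondDifference (B : ℚ) (S : ℕ → ℚ) (h0 : S 0 = 0) (M : ℕ) :
    ∑ m ∈ Finset.range M, ((m : ℚ) + 1) * (B - (m + 1)) * (2 * S (m + 1) - S (m + 2) - S m - 1) =
      2 * ∑ k ∈ Finset.range (M + 1), S k + (M + 1) * (B - M - 1) * S M - M * (B - M) * S (M + 1)
        - ∑ m ∈ Finset.range M, ((m : ℚ) + 1) * (B - (m + 1)) := by
  induction M with
  | zero => simp [h0]
  | succ M ih =>
    rw [Finset.sum_range_succ, ih, Finset.sum_range_succ _ (M + 1),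
      Finset.sum_range_succ (fun m : ℕ => ((m : ℚ) + 1) * (B - (m + 1))) M]
    push_cast
    ring

theorem IsPattern.rowSum_eq (hT : IsPattern N L T) : rowSum T N = ∑ i, L i :=
  Finset.sum_congr rfl fun i _ => hT.bottom i

theorem IsPattern.sum_mul_diagCoeff (hT : IsPattern N L T) :
    ∑ x ∈ boxes N, ((x.1 : ℚ) * ((N : ℚ) - x.1)) * diagCoeff x T = weight N L T := by
  rcases N with _ | M
  · simp [boxes, Finset.sum_sigma, weight, degree, weightShift]
  have hrow : ∀ m ∈ Finset.range M, ∑ i : Fin (m + 1),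
      (((m + 1 : ℕ) : ℚ) * (((M + 1 : ℕ) : ℚ) - (m + 1 : ℕ))) * diagCoeff ⟨m + 1, i⟩ T =
      ((m : ℚ) + 1) * (((M + 1 : ℕ) : ℚ) - (m + 1)) *
        (2 * (rowSum T (m + 1) : ℚ) - rowSum T (m + 2) - rowSum T m - 1) := by
    intro m hm
    rw [← Finset.mul_sum, hT.sum_diagCoeff (by simpa using hm), Nat.cast_succ m]
  rw [boxes, Finset.sum_sigma, Finset.sum_range_succ', Finset.sum_congr rfl hrow,
    sum_mul_secondDifference _ (fun k => (rowSum T k : ℚ)) (by simp [rowSum]), weight, weightShift,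
    degree, hT.rowSum_eq, Nat.add_sub_cancel]
  push_cast
  simp only [Finset.univ_eq_empty, Finset.sum_empty]
  ring

theorem degree_add_unitBox (T : Box → ℤ) (hx : x.1 < N) :
    degree N (T + unitBox x) = degree N T + 1 := by
  have hunit : ∑ y ∈ boxes N, unitBox x y = 1 := by
    rw [unitBox, Finset.sum_pi_single', if_pos (mem_boxes.2 hx)]
  simp only [degree, rowSum, Pi.add_apply, Finset.sum_add_distrib]
  rw [add_right_inj, ← hunit, boxes, Finset.sum_sigma]

theorem weight_add_unitBox (L : Fin N → ℤ) (T : Box → ℤ) (hx : x.1 < N) :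
    weight N L (T + unitBox x) = weight N L T + 2 := by
  rw [weight, degree_add_unitBox T hx, weight, Int.cast_add, Int.cast_one]
  ring

theorem weight_sub_unitBox (L : Fin N → ℤ) (T : Box → ℤ) (hx : x.1 < N) :
    weight N L (T - unitBox x) = weight N L T - 2 := by
  rw [eq_sub_iff_add_eq, ← weight_add_unitBox L _ hx, sub_add_cancel]

end Cartan

section Enumeration

/-- The array `T` with its row `n` replaced by `R`, which adds a bottom row to a pattern. -/
def setRow (n : ℕ) (R : Fin n → ℤ) (T : Box → ℤ) : Box → ℤ :=
  fun x => if h : x.1 = n then R (Fin.cast h x.2) else T x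

/-- The rows that interlace with the row `L`, in strict coordinates; they are the highest weights
of the branching rule from `gl_{N + 1}` to `gl_N`. -/
noncomputable def interlacing {N : ℕ} (L : Fin (N + 1) → ℤ) : Finset (Fin N → ℤ) :=
  Fintype.piFinset fun i : Fin N => Finset.Ioc (L i.succ) (L i.castSucc)

open Classical in
/-- The finite set of patterns with `N` rows and bottom row `L`, built row by row. -/
noncomputable def patterns : (N : ℕ) → (Fin N → ℤ) → Finset (Box → ℤ)
  | 0, _ => {0}
  | N + 1, L => (interlacing L).biUnion fun R => (patterns N R).image (setRow (N + 1) L)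

/-- The constant term of the least degree of a pattern, which comes from the shift by `i` of the
entries `i` in strict coordinates. -/
def degreeShift (N : ℕ) : ℤ := ∑ k ∈ Finset.range N, ∑ j ∈ Finset.range k, ((j : ℤ) + 1)

/-- The least degree of a pattern with bottom row `L`. -/
def minDegree {N : ℕ} (L : Fin N → ℤ) : ℤ := ∑ i : Fin N, (i : ℤ) * L i + degreeShift N

variable {N : ℕ} {T : Box → ℤ}

theorem setRow_self (n : ℕ) (R : Fin n → ℤ) (T : Box → ℤ) (i : Fin n) :
    setRow n R T ⟨n, i⟩ = R i :=
  dif_pos rfl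

theorem setRow_of_ne {n : ℕ} (R : Fin n → ℤ) (T : Box → ℤ) {x : Box} (h : x.1 ≠ n) :
    setRow n R T x = T x :=
  dif_neg h

theorem setRow_mk_of_ne {n k : ℕ} (R : Fin n → ℤ) (T : Box → ℤ) (h : k ≠ n) (i : Fin k) :
    setRow n R T ⟨k, i⟩ = T ⟨k, i⟩ :=
  setRow_of_ne R T h

theorem mem_interlacing {L : Fin (N + 1) → ℤ} {R : Fin N → ℤ} :
    R ∈ interlacing L ↔ ∀ i, L i.succ < R i ∧ R i ≤ L i.castSucc := by
  simp only [interlacing, Fintype.mem_piFinset, Finset.mem_Ioc]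

theorem strictAnti_of_mem_interlacing {L : Fin (N + 1) → ℤ} {R : Fin N → ℤ}
    (h : R ∈ interlacing L) : StrictAnti R := by
  rw [mem_interlacing] at h
  rcases N with _ | N
  · exact fun i => i.elim0
  · exact Fin.strictAnti_iff_succ_lt.2 fun i => (h i.succ).2.trans_lt (h i.castSucc).1

theorem isPattern_zero_iff {L : Fin 0 → ℤ} : IsPattern 0 L T ↔ T = 0 := by
  refine ⟨fun hT => funext fun x => hT.zero x x.2.pos, ?_⟩
  rintro rfl
  exact ⟨fun i => i.elim0, fun _ _ => rfl, fun k hk => absurd hk k.not_lt_zero,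
    fun k hk => absurd hk k.not_lt_zero⟩

theorem IsPattern.setRow_of_mem_interlacing {L : Fin (N + 1) → ℤ} {R : Fin N → ℤ}
    (hT : IsPattern N R T) (hR : R ∈ interlacing L) :
    IsPattern (N + 1) L (setRow (N + 1) L T) := by
  rw [mem_interlacing] at hR
  refine ⟨setRow_self _ L T, fun x hx => ?_, fun k hk i => ?_, fun k hk i => ?_⟩
  · rw [setRow_of_ne L T hx.ne', hT.zero x (by omega)]
  · rw [setRow_mk_of_ne L T hk.ne]
    obtain hk' | rfl := Nat.lt_succ_iff_lt_or_eq.1 hk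
    · rw [setRow_mk_of_ne L T (by omega)]
      exact hT.lt k hk' i
    · rw [setRow_self, hT.bottom]
      exact (hR i).1
  · rw [setRow_mk_of_ne L T hk.ne]
    obtain hk' | rfl := Nat.lt_succ_iff_lt_or_eq.1 hk
    · rw [setRow_mk_of_ne L T (by omega)]
      exact hT.le k hk' i
    · rw [setRow_self, hT.bottom]
      exact (hR i).2

theorem IsPattern.row_mem_interlacing {L : Fin (N + 1) → ℤ} (hT : IsPattern (N + 1) L T) :
    (fun i => T ⟨N, i⟩) ∈ interlacing L := by
  refine mem_interlacing.2 fun i => ?_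
  rw [← hT.bottom, ← hT.bottom]
  exact ⟨hT.lt N N.lt_succ_self i, hT.le N N.lt_succ_self i⟩

theorem IsPattern.setRow_zero {L : Fin (N + 1) → ℤ} (hT : IsPattern (N + 1) L T) :
    IsPattern N (fun i => T ⟨N, i⟩) (setRow (N + 1) 0 T) := by
  refine ⟨setRow_mk_of_ne 0 T N.lt_succ_self.ne, fun x hx => ?_, fun k hk i => ?_, fun k hk i => ?_⟩
  · rcases x with ⟨k, i⟩
    obtain rfl | hk := eq_or_ne k (N + 1)
    · exact setRow_self _ 0 T i
    · rw [setRow_mk_of_ne 0 T hk, hT.zero _ (lt_of_le_of_ne hx hk.symm)]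
  · rw [setRow_mk_of_ne 0 T (by omega), setRow_mk_of_ne 0 T (by omega)]
    exact hT.lt k (by omega) i
  · rw [setRow_mk_of_ne 0 T (by omega), setRow_mk_of_ne 0 T (by omega)]
    exact hT.le k (by omega) i

theorem IsPattern.setRow_setRow_zero {L : Fin (N + 1) → ℤ} (hT : IsPattern (N + 1) L T) :
    setRow (N + 1) L (setRow (N + 1) 0 T) = T := by
  ext ⟨k, i⟩
  obtain rfl | hk := eq_or_ne k (N + 1)
  · rw [setRow_self, hT.bottom]
  · rw [setRow_mk_of_ne _ _ hk, setRow_mk_of_ne _ _ hk]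

theorem mem_patterns {L : Fin N → ℤ} : T ∈ patterns N L ↔ IsPattern N L T := by
  induction N generalizing T with
  | zero => rw [patterns, Finset.mem_singleton, isPattern_zero_iff]
  | succ N ih =>
    simp only [patterns, Finset.mem_biUnion, Finset.mem_image, ih]
    constructor
    · rintro ⟨R, hR, S, hS, rfl⟩
      exact hS.setRow_of_mem_interlacing hR
    · exact fun hT => ⟨_, hT.row_mem_interlacing, _, hT.setRow_zero, hT.setRow_setRow_zero⟩

theorem setRow_injOn_patterns (L : Fin (N + 1) → ℤ) (R : Fin N → ℤ) :
    Set.InjOn (setRow (N + 1) L) (patterns N R) := by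
  intro S hS S' hS' h
  ext x
  by_cases hx : x.1 = N + 1
  · rw [(mem_patterns.1 hS).zero x (by omega), (mem_patterns.1 hS').zero x (by omega)]
  · rw [← setRow_of_ne L S hx, h, setRow_of_ne L S' hx]

open Classical in
theorem pairwiseDisjoint_image_setRow (L : Fin (N + 1) → ℤ) (s : Set (Fin N → ℤ)) :
    s.PairwiseDisjoint fun R => (patterns N R).image (setRow (N + 1) L) := by
  intro R _ R' _ hne
  refine Finset.disjoint_left.2 fun T hT hT' => hne (funext fun i => ?_)
  obtain ⟨S, hS, rfl⟩ := Finset.mem_image.1 hT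
  obtain ⟨S', hS', h⟩ := Finset.mem_image.1 hT'
  rw [← (mem_patterns.1 hS).bottom, ← (mem_patterns.1 hS').bottom,
    ← setRow_mk_of_ne L S N.lt_succ_self.ne, ← h, setRow_mk_of_ne L S' N.lt_succ_self.ne]

theorem IsPattern.degree_setRow {R : Fin N → ℤ} (hT : IsPattern N R T) (L : Fin (N + 1) → ℤ) :
    degree (N + 1) (setRow (N + 1) L T) = ∑ i, R i + degree N T := by
  have hrow : ∀ k ≤ N, rowSum (setRow (N + 1) L T) k = rowSum T k := fun k hk =>
    Finset.sum_congr rfl fun i _ => setRow_mk_of_ne L T (by omega) i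
  rw [degree, Finset.sum_range_succ, hrow N le_rfl, hT.rowSum_eq, add_comm, degree,
    Finset.sum_congr rfl fun k hk => hrow k (Finset.mem_range.1 hk).le]

theorem sum_patterns_succ {M : Type*} [AddCommMonoid M] (L : Fin (N + 1) → ℤ) (f : ℤ → M) :
    ∑ T ∈ patterns (N + 1) L, f (degree (N + 1) T) =
      ∑ R ∈ interlacing L, ∑ T ∈ patterns N R, f (∑ i, R i + degree N T) := by
  classical
  rw [patterns, Finset.sum_biUnion (pairwiseDisjoint_image_setRow L _)]
  refine Finset.sum_congr rfl fun R _ => ?_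
  rw [Finset.sum_image (setRow_injOn_patterns L R)]
  exact Finset.sum_congr rfl fun T hT => by rw [(mem_patterns.1 hT).degree_setRow]

theorem degreeShift_succ (N : ℕ) :
    degreeShift (N + 1) = degreeShift N + ∑ i : Fin N, ((i : ℤ) + 1) := by
  rw [degreeShift, Finset.sum_range_succ, ← Fin.sum_univ_eq_sum_range (fun j => (j : ℤ) + 1),
    degreeShift]

theorem le_sum_of_mem_interlacing {L : Fin (N + 1) → ℤ} {R : Fin N → ℤ} (hR : R ∈ interlacing L) :
    ∑ i : Fin (N + 1), (i : ℤ) * L i + ∑ i : Fin N, ((i : ℤ) + 1) ≤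
      ∑ i, R i + ∑ i : Fin N, (i : ℤ) * R i := by
  have hterm : ∀ i : Fin N, ((i : ℤ) + 1) * L i.succ + ((i : ℤ) + 1) ≤ R i + (i : ℤ) * R i := by
    intro i
    have hlt : L i.succ + 1 ≤ R i := (mem_interlacing.1 hR i).1
    linarith [mul_le_mul_of_nonneg_left hlt (by positivity : (0 : ℤ) ≤ (i : ℤ) + 1)]
  rw [Fin.sum_univ_succ, Fin.val_zero, Nat.cast_zero, zero_mul, zero_add,
    ← Finset.sum_add_distrib, ← Finset.sum_add_distrib]
  exact Finset.sum_le_sum fun i _ => by rw [Fin.val_succ, Nat.cast_succ]; exact hterm i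

theorem IsPattern.le_degree {L : Fin N → ℤ} (hT : IsPattern N L T) :
    minDegree L ≤ degree N T := by
  rw [minDegree]
  induction N generalizing T with
  | zero => simp [degreeShift, degree]
  | succ N ih =>
    rw [← hT.setRow_setRow_zero, hT.setRow_zero.degree_setRow, degreeShift_succ]
    linarith [ih hT.setRow_zero, le_sum_of_mem_interlacing hT.row_mem_interlacing]

end Enumeration

section Representation

open Module

attribute [local instance] LieRing.ofAssociativeRing

/-- The basis of the Gelfand–Tsetlin module with bottom row `L`. -/
abbrev Pattern (N : ℕ) (L : Fin N → ℤ) := {T : Box → ℤ // IsPattern N L T}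

/-- The number of patterns of degree `d` with bottom row `L`. -/
noncomputable def patternCount (N : ℕ) (L : Fin N → ℤ) (d : ℤ) : ℕ :=
  ((patterns N L).filter fun T => degree N T = d).card

/-- The diagonal operator with eigenvalues `w`. -/
noncomputable def diagonalOp {K ι : Type*} [Field K] (w : ι → K) : End K (ι →₀ K) :=
  Finsupp.linearCombination K fun i => Finsupp.single i (w i)

open Classical in
/-- The basis vector of the pattern `T`, and `0` when the array `T` is not a pattern. -/
noncomputable def patternVector (N : ℕ) (L : Fin N → ℤ) (T : Box → ℤ) : Pattern N L →₀ ℚ :=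
  if h : IsPattern N L T then Finsupp.single ⟨T, h⟩ 1 else 0

/-- The part of the raising operator that increases the entry in the box `x`. -/
noncomputable def raiseBox (N : ℕ) (L : Fin N → ℤ) (x : Box) : End ℚ (Pattern N L →₀ ℚ) :=
  Finsupp.linearCombination ℚ fun T => raiseCoeff x T.1 • patternVector N L (T.1 + unitBox x)

/-- The part of the lowering operator that decreases the entry in the box `x`. -/
noncomputable def lowerBox (N : ℕ) (L : Fin N → ℤ) (x : Box) : End ℚ (Pattern N L →₀ ℚ) :=
  Finsupp.linearCombination ℚ fun T => lowerCoeff x T.1 • patternVector N L (T.1 - unitBox x)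

/-- The raising operator of the principal `sl₂`, the sum of those of the simple roots of `gl_N`. -/
noncomputable def raiseOp (N : ℕ) (L : Fin N → ℤ) : End ℚ (Pattern N L →₀ ℚ) :=
  ∑ x ∈ boxes N, raiseBox N L x

/-- The lowering operator of the principal `sl₂`. The simple root `k` has the factor `k (N - k)`,
its coefficient in the sum of the positive coroots. -/
noncomputable def lowerOp (N : ℕ) (L : Fin N → ℤ) : End ℚ (Pattern N L →₀ ℚ) :=
  ∑ x ∈ boxes N, ((x.1 : ℚ) * ((N : ℚ) - x.1)) • lowerBox N L x

/-- The Cartan element of the principal `sl₂`. -/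
noncomputable def cartanOp (N : ℕ) (L : Fin N → ℤ) : End ℚ (Pattern N L →₀ ℚ) :=
  diagonalOp fun T => weight N L T.1

theorem lie_end_apply {K V : Type*} [Field K] [AddCommGroup V] [Module K V] (A B : End K V)
    (v : V) : ⁅A, B⁆ v = A (B v) - B (A v) := by
  rw [LieRing.of_associative_ring_bracket, LinearMap.sub_apply, End.mul_apply, End.mul_apply]

-- This is `lie_smul`, whose instances `rw` does not unify with those of `Module.End`.
theorem lie_smul_end {K V : Type*} [Field K] [AddCommGroup V] [Module K V] (c : K)
    (A B : End K V) : ⁅A, c • B⁆ = c • ⁅A, B⁆ :=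
  lie_smul c A B

section Diagonal

variable {K ι : Type*} [Field K]

theorem diagonalOp_apply (w : ι → K) (v : ι →₀ K) (i : ι) : diagonalOp w v i = w i * v i := by
  classical
  rw [diagonalOp, Finsupp.linearCombination_apply, Finsupp.sum_apply]
  simp only [Finsupp.smul_apply, Finsupp.single_apply, smul_eq_mul, mul_ite, mul_zero]
  rw [Finsupp.sum_ite_eq', mul_comm]
  simp +contextual

theorem eigenspace_diagonalOp (w : ι → K) (μ : K) :
    End.eigenspace (diagonalOp w) μ = Finsupp.supported K K {i | w i = μ} := by
  ext v
  simp only [End.mem_eigenspace_iff, Finsupp.mem_supported', DFunLike.ext_iff, diagonalOp_apply,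
    Finsupp.smul_apply, smul_eq_mul, mul_eq_mul_right_iff, Set.mem_ofPred_eq, or_iff_not_imp_left]

theorem finrank_eigenspace_diagonalOp [Finite ι] (w : ι → K) (μ : K) :
    finrank K (End.eigenspace (diagonalOp w) μ) = {i | w i = μ}.ncard := by
  have := Fintype.ofFinite {i | w i = μ}
  rw [eigenspace_diagonalOp, (Finsupp.supportedEquivFinsupp {i | w i = μ}).finrank_eq,
    finrank_finsupp_self, Set.ncard_eq_toFinset_card', Set.toFinset_card]

end Diagonal

variable {N : ℕ} {L : Fin N → ℤ} {T : Box → ℤ} {x y : Box}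

instance : Finite (Pattern N L) :=
  Finite.of_injective (fun T : Pattern N L => (⟨T.1, mem_patterns.2 T.2⟩ : patterns N L))
    fun _ _ h => Subtype.ext (congrArg (fun S : patterns N L => S.1) h)

theorem patternVector_of_not_isPattern (h : ¬ IsPattern N L T) : patternVector N L T = 0 :=
  dif_neg h

theorem linearCombination_patternVector (hT : IsPattern N L T) (f : (Box → ℤ) → Pattern N L →₀ ℚ) :
    Finsupp.linearCombination ℚ (fun S : Pattern N L => f S.1) (patternVector N L T) = f T := by
  rw [patternVector, dif_pos hT, Finsupp.linearCombination_single, one_smul]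

theorem raiseBox_patternVector (hT : IsPattern N L T) (x : Box) :
    raiseBox N L x (patternVector N L T) = raiseCoeff x T • patternVector N L (T + unitBox x) :=
  linearCombination_patternVector hT fun S => raiseCoeff x S • patternVector N L (S + unitBox x)

theorem lowerBox_patternVector (hT : IsPattern N L T) (x : Box) :
    lowerBox N L x (patternVector N L T) = lowerCoeff x T • patternVector N L (T - unitBox x) :=
  linearCombination_patternVector hT fun S => lowerCoeff x S • patternVector N L (S - unitBox x)

theorem cartanOp_patternVector (T : Box → ℤ) :
    cartanOp N L (patternVector N L T) = weight N L T • patternVector N L T := by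
  classical
  ext S
  rw [cartanOp, diagonalOp_apply, Finsupp.smul_apply, smul_eq_mul]
  by_cases hT : IsPattern N L T
  · rw [patternVector, dif_pos hT, Finsupp.single_apply]
    split_ifs with h
    · rw [← h]
    · rw [mul_zero, mul_zero]
  · rw [patternVector_of_not_isPattern hT, Finsupp.zero_apply, mul_zero, mul_zero]

theorem ext_patternVector {A B : End ℚ (Pattern N L →₀ ℚ)}
    (h : ∀ T, IsPattern N L T → A (patternVector N L T) = B (patternVector N L T)) : A = B := by
  refine Finsupp.lhom_ext' fun T => LinearMap.ext_ring ?_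
  have hT := h T.1 T.2
  rwa [patternVector, dif_pos T.2] at hT

theorem raiseBox_patternVector_eq_zero (h : ¬ IsPattern N L (T + unitBox x)) :
    raiseBox N L x (patternVector N L T) = 0 := by
  by_cases hT : IsPattern N L T
  · rw [raiseBox_patternVector hT, patternVector_of_not_isPattern h, smul_zero]
  · rw [patternVector_of_not_isPattern hT, map_zero]

theorem lowerBox_patternVector_eq_zero (h : ¬ IsPattern N L (T - unitBox x)) :
    lowerBox N L x (patternVector N L T) = 0 := by
  by_cases hT : IsPattern N L T
  · rw [lowerBox_patternVector hT, patternVector_of_not_isPattern h, smul_zero]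
  · rw [patternVector_of_not_isPattern hT, map_zero]

theorem raiseBox_lowerBox_self (hT : IsPattern N L T) (hx : x.1 < N) :
    raiseBox N L x (lowerBox N L x (patternVector N L T)) =
      (raiseCoeff x (T - unitBox x) * lowerCoeff x T) • patternVector N L T := by
  rw [lowerBox_patternVector hT, map_smul]
  by_cases h : IsPattern N L (T - unitBox x)
  · rw [raiseBox_patternVector h, sub_add_cancel, smul_smul, mul_comm]
  · rw [patternVector_of_not_isPattern h, map_zero, smul_zero, hT.raise_lower_eq_zero hx h,
      zero_smul]

theorem lowerBox_raiseBox_self (hT : IsPattern N L T) (hx : x.1 < N) :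
    lowerBox N L x (raiseBox N L x (patternVector N L T)) =
      (lowerCoeff x (T + unitBox x) * raiseCoeff x T) • patternVector N L T := by
  rw [raiseBox_patternVector hT, map_smul]
  by_cases h : IsPattern N L (T + unitBox x)
  · rw [lowerBox_patternVector h, add_sub_cancel_right, smul_smul, mul_comm]
  · rw [patternVector_of_not_isPattern h, map_zero, smul_zero, hT.lower_raise_eq_zero hx h,
      zero_smul]

theorem lie_raiseBox_lowerBox_self (hT : IsPattern N L T) (hx : x.1 < N) :
    ⁅raiseBox N L x, lowerBox N L x⁆ (patternVector N L T) =
      diagCoeff x T • patternVector N L T := by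
  rw [lie_end_apply, raiseBox_lowerBox_self hT hx, lowerBox_raiseBox_self hT hx, ← sub_smul,
    diagCoeff]

theorem lie_raiseBox_lowerBox_of_ne (hx : x.1 < N) (hy : y.1 < N) (hxy : x ≠ y) :
    ⁅raiseBox N L x, lowerBox N L y⁆ = 0 := by
  refine ext_patternVector fun T hT => ?_
  have hcomm : T - unitBox y + unitBox x = T + unitBox x - unitBox y := by abel
  rw [lie_end_apply, LinearMap.zero_apply, sub_eq_zero, lowerBox_patternVector hT,
    raiseBox_patternVector hT, map_smul, map_smul]
  by_cases h : IsPattern N L (T + unitBox x - unitBox y)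
  · rw [raiseBox_patternVector (hT.sub_unitBox_of_add_sub h hy hxy),
      lowerBox_patternVector (hT.add_unitBox_of_add_sub h hx hxy), hcomm, smul_smul, smul_smul,
      mul_comm, raiseCoeff_mul_lowerCoeff_comm T hxy, mul_comm]
  · rw [raiseBox_patternVector_eq_zero (hcomm ▸ h), lowerBox_patternVector_eq_zero h, smul_zero,
      smul_zero]

theorem lie_raiseOp_lowerOp (N : ℕ) (L : Fin N → ℤ) :
    ⁅raiseOp N L, lowerOp N L⁆ = cartanOp N L := by
  have hdiag : ⁅raiseOp N L, lowerOp N L⁆ =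
      ∑ x ∈ boxes N, ((x.1 : ℚ) * ((N : ℚ) - x.1)) • ⁅raiseBox N L x, lowerBox N L x⁆ := by
    rw [raiseOp, lowerOp, sum_lie_sum]
    refine Finset.sum_congr rfl fun x hx => ?_
    rw [Finset.sum_eq_single_of_mem x hx, lie_smul_end]
    intro y hy hyx
    rw [lie_smul_end, lie_raiseBox_lowerBox_of_ne (mem_boxes.1 hx) (mem_boxes.1 hy) hyx.symm,
      smul_zero]
  refine ext_patternVector fun T hT => ?_
  rw [hdiag, cartanOp_patternVector, ← hT.sum_mul_diagCoeff, LinearMap.sum_apply, Finset.sum_smul]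
  refine Finset.sum_congr rfl fun x hx => ?_
  rw [LinearMap.smul_apply, lie_raiseBox_lowerBox_self hT (mem_boxes.1 hx), smul_smul]

theorem lie_cartanOp_raiseBox (hx : x.1 < N) :
    ⁅cartanOp N L, raiseBox N L x⁆ = 2 • raiseBox N L x := by
  refine ext_patternVector fun T hT => ?_
  rw [lie_end_apply, cartanOp_patternVector, map_smul, LinearMap.smul_apply,
    raiseBox_patternVector hT, map_smul, cartanOp_patternVector, weight_add_unitBox L T hx]
  module

theorem lie_cartanOp_lowerBox (hx : x.1 < N) :
    ⁅cartanOp N L, lowerBox N L x⁆ = -(2 • lowerBox N L x) := by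
  refine ext_patternVector fun T hT => ?_
  rw [lie_end_apply, cartanOp_patternVector, map_smul, LinearMap.neg_apply, LinearMap.smul_apply,
    lowerBox_patternVector hT, map_smul, cartanOp_patternVector, weight_sub_unitBox L T hx]
  module

theorem lie_cartanOp_raiseOp (N : ℕ) (L : Fin N → ℤ) :
    ⁅cartanOp N L, raiseOp N L⁆ = 2 • raiseOp N L := by
  rw [raiseOp, lie_sum, Finset.smul_sum]
  exact Finset.sum_congr rfl fun x hx => lie_cartanOp_raiseBox (mem_boxes.1 hx)

theorem lie_cartanOp_lowerOp (N : ℕ) (L : Fin N → ℤ) :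
    ⁅cartanOp N L, lowerOp N L⁆ = -(2 • lowerOp N L) := by
  rw [lowerOp, lie_sum, Finset.smul_sum, ← Finset.sum_neg_distrib]
  refine Finset.sum_congr rfl fun x hx => ?_
  rw [lie_smul_end, lie_cartanOp_lowerBox (mem_boxes.1 hx)]
  module

theorem isSl2Triple (h : cartanOp N L ≠ 0) :
    IsSl2Triple (cartanOp N L) (raiseOp N L) (lowerOp N L) where
  h_ne_zero := h
  lie_e_f := lie_raiseOp_lowerOp N L
  lie_h_e_nsmul := lie_cartanOp_raiseOp N L
  lie_h_f_nsmul := lie_cartanOp_lowerOp N L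

theorem finrank_eigenspace_cartanOp (N : ℕ) (L : Fin N → ℤ) (d : ℤ) :
    finrank ℚ (End.eigenspace (cartanOp N L) (2 * (d : ℚ) + weightShift N L)) =
      patternCount N L d := by
  rw [cartanOp, finrank_eigenspace_diagonalOp, patternCount, ← Set.ncard_coe_finset,
    ← Set.ncard_image_of_injective _ Subtype.val_injective]
  congr 1
  ext T
  simp [weight, mem_patterns, and_comm]

theorem cartanOp_ne_zero {μ : ℚ} (hμ : μ ≠ 0)
    (h : finrank ℚ (End.eigenspace (cartanOp N L) μ) ≠ 0) : cartanOp N L ≠ 0 := by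
  intro hzero
  refine h (Submodule.finrank_eq_zero.2 (eq_bot_iff.2 fun v hv => ?_))
  rw [End.mem_eigenspace_iff, hzero, LinearMap.zero_apply, eq_comm, smul_eq_zero] at hv
  exact hv.resolve_left hμ

theorem finrank_eigenspace_cartanOp_le_add_two {μ : ℚ} (hμ : μ < 0) :
    finrank ℚ (End.eigenspace (cartanOp N L) μ) ≤
      finrank ℚ (End.eigenspace (cartanOp N L) (μ + 2)) := by
  by_cases h : finrank ℚ (End.eigenspace (cartanOp N L) μ) = 0
  · exact h.le.trans (Nat.zero_le _)
  · exact finrank_eigenspace_le_add_two_of_isSl2Triple (M := Pattern N L →₀ ℚ)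
      (isSl2Triple (cartanOp_ne_zero hμ.ne h)) hμ

theorem finrank_eigenspace_cartanOp_le_sub_two {μ : ℚ} (hμ : 0 < μ) :
    finrank ℚ (End.eigenspace (cartanOp N L) μ) ≤
      finrank ℚ (End.eigenspace (cartanOp N L) (μ - 2)) := by
  by_cases h : finrank ℚ (End.eigenspace (cartanOp N L) μ) = 0
  · exact h.le.trans (Nat.zero_le _)
  · exact finrank_eigenspace_le_sub_two_of_isSl2Triple (M := Pattern N L →₀ ℚ)
      (isSl2Triple (cartanOp_ne_zero hμ.ne' h)) hμ

theorem patternCount_le_add_one {d : ℤ} (hd : 2 * (d : ℚ) + weightShift N L < 0) :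
    patternCount N L d ≤ patternCount N L (d + 1) := by
  have h := finrank_eigenspace_cartanOp_le_add_two (L := L) hd
  rwa [finrank_eigenspace_cartanOp, show 2 * (d : ℚ) + weightShift N L + 2 =
    2 * ((d + 1 : ℤ) : ℚ) + weightShift N L by push_cast; ring, finrank_eigenspace_cartanOp] at h

theorem patternCount_le_sub_one {d : ℤ} (hd : 0 < 2 * (d : ℚ) + weightShift N L) :
    patternCount N L d ≤ patternCount N L (d - 1) := by
  have h := finrank_eigenspace_cartanOp_le_sub_two (L := L) hd
  rwa [finrank_eigenspace_cartanOp, show 2 * (d : ℚ) + weightShift N L - 2 =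
    2 * ((d - 1 : ℤ) : ℚ) + weightShift N L by push_cast; ring, finrank_eigenspace_cartanOp] at h

end Representation

section GeneratingFunction

open Finset

variable {K : Type*} [Field K] {q : K} {N : ℕ}

theorem prod_zpow_eq_zpow_sum (hq : q ≠ 0) {ι : Type*} (s : Finset ι) (f : ι → ℤ) :
    ∏ i ∈ s, q ^ f i = q ^ ∑ i ∈ s, f i := by
  classical
  induction s using Finset.induction_on with
  | empty => simp
  | insert a s ha ih => rw [sum_insert ha, prod_insert ha, zpow_add₀ hq, ih]

theorem sum_Ioc_zpow_mul (hq : q ≠ 0) {a b : ℤ} (hab : a ≤ b) :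
    (∑ m ∈ Ioc a b, q ^ m) * (q⁻¹ - 1) = q ^ a - q ^ b := by
  induction b, hab using Int.leInduction with
  | base => simp
  | succ b hab ih =>
    rw [← insert_Ioc_right_eq_Ioc_add_one hab, sum_insert (by simp), add_mul, ih,
      zpow_add_one₀ hq]
    field_simp
    ring

theorem det_vandermonde_eq_det_sub {R : Type*} [CommRing R] (x : Fin (N + 1) → R) :
    (Matrix.vandermonde x).det =
      (Matrix.of fun i j : Fin N =>
        x i.succ ^ ((j : ℕ) + 1) - x i.castSucc ^ ((j : ℕ) + 1)).det := by
  rw [Matrix.det_eq_of_forall_row_eq_smul_add_pred (A := Matrix.vandermonde x)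
    (B := Matrix.of fun i j => Fin.cases (motive := fun _ => R) (x 0 ^ (j : ℕ))
      (fun i => x i.succ ^ (j : ℕ) - x i.castSucc ^ (j : ℕ)) i) (fun _ => 1)
    (fun j => by simp [Matrix.vandermonde_apply]) (fun i j => by simp [Matrix.vandermonde_apply]),
    Matrix.det_succ_column_zero, Fin.sum_univ_succ]
  simp only [Matrix.of_apply, Fin.cases_zero, Fin.cases_succ, Fin.val_zero, pow_zero, sub_self,
    mul_zero, zero_mul, sum_const_zero, add_zero, one_mul, mul_one]
  congr 1

theorem zpow_sum_mul_det_vandermonde (hq : q ≠ 0) (R : Fin N → ℤ) :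
    q ^ (∑ i, R i) * (Matrix.vandermonde fun i => q ^ R i).det =
      (Matrix.of fun i j : Fin N => (q ^ ((j : ℕ) + 1)) ^ R i).det := by
  rw [← prod_zpow_eq_zpow_sum hq, ← Matrix.det_mul_column]
  congr 1
  ext i j
  rw [Matrix.of_apply, Matrix.of_apply, Matrix.vandermonde_apply, ← pow_succ',
    ← zpow_natCast, ← zpow_natCast, ← zpow_mul, ← zpow_mul, mul_comm]

theorem sum_piFinset_det {R n ι : Type*} [CommRing R] [Fintype n] [DecidableEq n]
    (s : n → Finset ι) (g : ι → n → R) :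
    ∑ r ∈ Fintype.piFinset s, (Matrix.of fun i j => g (r i) j).det =
      (Matrix.of fun i j => ∑ m ∈ s i, g m j).det := by
  have h := Matrix.detRowAlternating.toMultilinearMap.map_sum_finset (fun _ : n => g) s
  simp only [← Finset.sum_apply]
  exact h.symm

-- The branching rule from `gl_{N + 1}` to `gl_N`, with characters multiplied by their denominators.
theorem sum_interlacing_det_vandermonde (hq : q ≠ 0) {L : Fin (N + 1) → ℤ} (hL : StrictAnti L) :
    (∑ R ∈ interlacing L, q ^ (∑ i, R i) * (Matrix.vandermonde fun i => q ^ R i).det) *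
      ∏ j ∈ range N, ((q ^ (j + 1))⁻¹ - 1) =
      (Matrix.vandermonde fun i => q ^ L i).det := by
  rw [sum_congr rfl fun R _ => zpow_sum_mul_det_vandermonde hq R, interlacing,
    sum_piFinset_det _ fun (m : ℤ) (j : Fin N) => (q ^ ((j : ℕ) + 1)) ^ m,
    det_vandermonde_eq_det_sub, ← Fin.prod_univ_eq_prod_range (fun j => (q ^ (j + 1))⁻¹ - 1),
    mul_comm, ← Matrix.det_mul_row]
  congr 1
  ext i j
  rw [Matrix.of_apply, Matrix.of_apply, Matrix.of_apply, mul_comm,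
    sum_Ioc_zpow_mul (pow_ne_zero _ hq) (hL Fin.castSucc_lt_succ).le]
  simp only [← zpow_natCast, ← zpow_mul, mul_comm]

theorem sum_patterns_mul (hq : q ≠ 0) {L : Fin N → ℤ} (hL : StrictAnti L) :
    (∑ T ∈ patterns N L, q ^ degree N T) *
      ∏ k ∈ range N, ∏ j ∈ range k, ((q ^ (j + 1))⁻¹ - 1) =
      (Matrix.vandermonde fun i => q ^ L i).det := by
  induction N with
  | zero => simp [patterns, degree]
  | succ N ih =>
    rw [sum_patterns_succ L (fun d => q ^ d), prod_range_succ, ← mul_assoc,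
      sum_mul, ← sum_interlacing_det_vandermonde hq hL]
    congr 1
    refine sum_congr rfl fun R hR => ?_
    rw [← ih (strictAnti_of_mem_interlacing hR), ← mul_assoc, mul_sum]
    simp only [zpow_add₀ hq]

theorem prod_prod_inv_sub_one (hq : q ≠ 0) (N : ℕ) :
    ∏ k ∈ range N, ∏ j ∈ range k, ((q ^ (j + 1))⁻¹ - 1) =
      q ^ (-degreeShift N) * ∏ k ∈ range N, ∏ j ∈ range k, (1 - q ^ (j + 1)) := by
  have hterm : ∀ j : ℕ, (q ^ (j + 1))⁻¹ - 1 = q ^ (-((j : ℤ) + 1)) * (1 - q ^ (j + 1)) := by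
    intro j
    rw [zpow_neg, ← Nat.cast_succ, zpow_natCast, mul_sub, mul_one,
      inv_mul_cancel₀ (pow_ne_zero _ hq)]
  simp only [hterm, prod_mul_distrib, prod_zpow_eq_zpow_sum hq, sum_neg_distrib, degreeShift]

theorem det_vandermonde_zpow (hq : q ≠ 0) (L : Fin N → ℤ) :
    (Matrix.vandermonde fun i => q ^ L i).det =
      q ^ (∑ i : Fin N, (i : ℤ) * L i) * ∏ i, ∏ j ∈ Ioi i, (1 - q ^ (L i - L j)) := by
  have hpow : ∏ i : Fin N, ∏ j ∈ Ioi i, q ^ L j = q ^ (∑ i : Fin N, (i : ℤ) * L i) := by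
    rw [prod_comm' (t' := univ) (s' := fun j => Iio j) (by simp), ← prod_zpow_eq_zpow_sum hq]
    refine prod_congr rfl fun j _ => ?_
    rw [prod_const, Fin.card_Iio, mul_comm, zpow_mul, zpow_natCast]
  rw [Matrix.det_vandermonde, ← hpow, ← prod_mul_distrib]
  refine prod_congr rfl fun i _ => ?_
  rw [← prod_mul_distrib]
  refine prod_congr rfl fun j _ => ?_
  rw [mul_sub, mul_one, ← zpow_add₀ hq, add_sub_cancel]

theorem sum_patterns_zpow_mul (hq : q ≠ 0) {L : Fin N → ℤ} (hL : StrictAnti L) :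
    (∑ T ∈ patterns N L, q ^ (degree N T - minDegree L)) *
      ∏ k ∈ range N, ∏ j ∈ range k, (1 - q ^ (j + 1)) =
      ∏ i, ∏ j ∈ Ioi i, (1 - q ^ (L i - L j)) := by
  have h := sum_patterns_mul hq hL
  rw [prod_prod_inv_sub_one hq, det_vandermonde_zpow hq] at h
  apply mul_left_cancel₀ (zpow_ne_zero (∑ i : Fin N, (i : ℤ) * L i) hq)
  rw [← h, ← mul_assoc, ← mul_assoc, mul_sum,
    sum_mul _ _ (q ^ (-degreeShift N))]
  congr 1
  refine sum_congr rfl fun T _ => ?_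
  rw [← zpow_add₀ hq, ← zpow_add₀ hq]
  congr 1
  rw [minDegree]
  ring

end GeneratingFunction

section PatternPolynomial

open Finset Polynomial

/-- The generating polynomial of the patterns with bottom row `L` by their degree above the least
one. -/
noncomputable def patternPoly {N : ℕ} (L : Fin N → ℤ) : ℤ[X] :=
  ∑ T ∈ patterns N L, X ^ (degree N T - minDegree L).toNat

/-- The product of the `q`-factorials of `0, …, N - 1`, without their denominators `1 - q`. -/
noncomputable def factorialPoly (N : ℕ) : ℤ[X] := ∏ k ∈ range N, ∏ j ∈ range k, (1 - X ^ (j + 1))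

variable {N : ℕ} {L : Fin N → ℤ}

theorem coeff_patternPoly (L : Fin N → ℤ) (n : ℕ) :
    (patternPoly L).coeff n = patternCount N L (minDegree L + n) := by
  simp only [patternPoly, finsetSum_coeff, coeff_X_pow, sum_boole, patternCount]
  congr 2
  refine filter_congr fun T hT => ?_
  have hle := (mem_patterns.1 hT).le_degree
  omega

theorem isUnimodal_of_coeff {P : ℤ[X]} (c : ℚ)
    (hlt : ∀ i : ℕ, (i : ℚ) < c → P.coeff i ≤ P.coeff (i + 1))
    (hgt : ∀ i : ℕ, c < i + 1 → P.coeff (i + 1) ≤ P.coeff i) : IsUnimodal P := by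
  refine ⟨min ⌈c⌉₊ P.natDegree, min_le_right _ _, fun i hi => hlt i ?_, fun i hi hdeg => hgt i ?_⟩
  · exact Nat.lt_ceil.1 (hi.trans_le (min_le_left _ _))
  · have hceil : ⌈c⌉₊ ≤ i := (min_le_iff.1 hi).resolve_right hdeg.not_ge
    exact (Nat.ceil_le.1 hceil).trans_lt (lt_add_one _)

theorem isUnimodal_patternPoly (L : Fin N → ℤ) : IsUnimodal (patternPoly L) := by
  refine isUnimodal_of_coeff (-(weightShift N L / 2 + minDegree L)) (fun i hi => ?_) fun i hi => ?_
  · have h : patternCount N L (minDegree L + i) ≤ patternCount N L (minDegree L + i + 1) :=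
      patternCount_le_add_one (by push_cast; linarith)
    rw [coeff_patternPoly, coeff_patternPoly, Nat.cast_succ, ← add_assoc]
    exact_mod_cast h
  · have h : patternCount N L (minDegree L + i + 1) ≤ patternCount N L (minDegree L + i + 1 - 1) :=
      patternCount_le_sub_one (by push_cast; linarith)
    rw [add_sub_cancel_right] at h
    rw [coeff_patternPoly, coeff_patternPoly, Nat.cast_succ, ← add_assoc]
    exact_mod_cast h

theorem algebraMap_patternPoly (L : Fin N → ℤ) :
    algebraMap ℤ[X] (RatFunc ℤ) (patternPoly L) =
      ∑ T ∈ patterns N L, (RatFunc.X : RatFunc ℤ) ^ (degree N T - minDegree L) := by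
  rw [patternPoly, map_sum]
  refine sum_congr rfl fun T hT => ?_
  rw [map_pow, RatFunc.algebraMap_X, ← zpow_natCast,
    Int.toNat_sub_of_le (mem_patterns.1 hT).le_degree]

-- The `q`-analogue of Weyl's dimension formula for `gl_N`.
theorem patternPoly_mul_factorialPoly (hL : StrictAnti L) :
    patternPoly L * factorialPoly N = ∏ i, ∏ j ∈ Ioi i, (1 - X ^ (L i - L j).toNat) := by
  apply RatFunc.algebraMap_injective ℤ
  have hpow : ∀ i, ∀ j ∈ Ioi i, (RatFunc.X : RatFunc ℤ) ^ (L i - L j).toNat =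
      RatFunc.X ^ (L i - L j) := fun i j hj => by
    rw [← zpow_natCast, Int.toNat_sub_of_le (hL (mem_Ioi.1 hj)).le]
  have hX : (RatFunc.X : RatFunc ℤ) ≠ 0 := by
    rw [← RatFunc.algebraMap_X, Ne, FaithfulSMul.algebraMap_eq_zero_iff]
    exact X_ne_zero
  have h := sum_patterns_zpow_mul hX hL
  rw [← algebraMap_patternPoly] at h
  simp only [factorialPoly, map_mul, map_prod, map_sub, map_one, map_pow, RatFunc.algebraMap_X]
  rw [h]
  exact prod_congr rfl fun i _ => prod_congr rfl fun j hj => by rw [hpow i j hj]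

end PatternPolynomial

section OneSubXPow

open Polynomial

variable {R : Type*} [CommRing R]

theorem one_sub_X_pow_ne_zero [Nontrivial R] {k : ℕ} (hk : 0 < k) : (1 - X ^ k : R[X]) ≠ 0 := by
  rw [← neg_sub, neg_ne_zero, ← C_1]
  exact X_pow_sub_C_ne_zero hk 1

theorem natDegree_one_sub_X_pow [Nontrivial R] (k : ℕ) : (1 - X ^ k : R[X]).natDegree = k := by
  rw [← neg_sub, natDegree_neg, ← C_1, natDegree_X_pow_sub_C]

theorem reverse_one_sub_X_pow [Nontrivial R] (k : ℕ) :
    (1 - X ^ k : R[X]).reverse = -(1 - X ^ k) := by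
  rw [reverse, natDegree_one_sub_X_pow, reflect_sub, ← C_1, reflect_C, reflect_monomial,
    revAt_le le_rfl, Nat.sub_self, pow_zero, C_1, one_mul, neg_sub]

variable [IsDomain R] {ι : Type*} {s : Finset ι} {f g : ι → ℕ}

theorem prod_one_sub_X_pow_ne_zero (hf : ∀ i ∈ s, 0 < f i) :
    (∏ i ∈ s, (1 - X ^ f i) : R[X]) ≠ 0 :=
  Finset.prod_ne_zero_iff.2 fun i hi => one_sub_X_pow_ne_zero (hf i hi)

theorem natDegree_prod_one_sub_X_pow (hf : ∀ i ∈ s, 0 < f i) :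
    (∏ i ∈ s, (1 - X ^ f i) : R[X]).natDegree = ∑ i ∈ s, f i := by
  rw [natDegree_prod _ _ fun i hi => one_sub_X_pow_ne_zero (hf i hi)]
  exact Finset.sum_congr rfl fun i _ => natDegree_one_sub_X_pow (f i)

theorem reverse_prod_one_sub_X_pow (s : Finset ι) (f : ι → ℕ) :
    (∏ i ∈ s, (1 - X ^ f i) : R[X]).reverse = (-1) ^ s.card * ∏ i ∈ s, (1 - X ^ f i) := by
  classical
  induction s using Finset.induction_on with
  | empty => rw [Finset.prod_empty, ← C_1, reverse_C, Finset.card_empty, pow_zero, one_mul]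
  | insert a s ha ih =>
    rw [Finset.prod_insert ha, reverse_mul_of_domain, ih, reverse_one_sub_X_pow,
      Finset.card_insert_of_notMem ha]
    ring

theorem reverse_eq_self_of_mul_prod_eq {P : R[X]} (hf : ∀ i ∈ s, 0 < f i)
    (h : P * ∏ i ∈ s, (1 - X ^ f i) = ∏ i ∈ s, (1 - X ^ g i)) : P.reverse = P := by
  have hrev := congrArg reverse h
  rw [reverse_mul_of_domain, reverse_prod_one_sub_X_pow, reverse_prod_one_sub_X_pow, ← h,
    mul_left_comm] at hrev
  have hsign : ((-1) ^ s.card : R[X]) ≠ 0 := pow_ne_zero _ (neg_ne_zero.2 one_ne_zero)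
  exact mul_right_cancel₀ (prod_one_sub_X_pow_ne_zero hf) (mul_left_cancel₀ hsign hrev)

theorem natDegree_add_sum_eq_of_mul_prod_eq {P : R[X]} (hP : P ≠ 0) (hf : ∀ i ∈ s, 0 < f i)
    (hg : ∀ i ∈ s, 0 < g i) (h : P * ∏ i ∈ s, (1 - X ^ f i) = ∏ i ∈ s, (1 - X ^ g i)) :
    P.natDegree + ∑ i ∈ s, f i = ∑ i ∈ s, g i := by
  rw [← natDegree_prod_one_sub_X_pow (R := R) hf, ← natDegree_prod_one_sub_X_pow (R := R) hg, ← h,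
    natDegree_mul hP (prod_one_sub_X_pow_ne_zero hf)]

theorem isSymmetric_of_reverse_eq {P : ℤ[X]} (h : P.reverse = P) : IsSymmetric P := fun i hi => by
  rw [← revAt_le hi, ← coeff_reverse, h]

end OneSubXPow

section Diagram

open Finset

variable (lam : YoungDiagram) {N : ℕ}

theorem lt_rowLen_iff {i j : ℕ} : j < lam.rowLen i ↔ i < lam.colLen j := by
  rw [← YoungDiagram.mem_iff_lt_rowLen, YoungDiagram.mem_iff_lt_colLen]

theorem mem_cells_iff_row (hN : lam.colLen 0 ≤ N) (x : ℕ × ℕ) :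
    x ∈ lam.cells ↔ x.1 ∈ range N ∧ x.2 ∈ range (lam.rowLen x.1) := by
  rw [YoungDiagram.mem_cells, YoungDiagram.mem_iff_lt_rowLen, mem_range, mem_range, iff_and_self,
    lt_rowLen_iff]
  exact fun h => h.trans_le ((lam.colLen_anti 0 _ (Nat.zero_le _)).trans hN)

theorem mem_cells_iff_col (x : ℕ × ℕ) :
    x ∈ lam.cells ↔ x.2 ∈ range (lam.rowLen 0) ∧ x.1 ∈ range (lam.colLen x.2) := by
  rw [YoungDiagram.mem_cells, YoungDiagram.mem_iff_lt_colLen, mem_range, mem_range, iff_and_self,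
    lt_rowLen_iff]
  exact fun h => (Nat.zero_le _).trans_lt h

theorem fst_lt_of_mem_cells (hN : lam.colLen 0 ≤ N) {x : ℕ × ℕ} (hx : x ∈ lam.cells) : x.1 < N :=
  mem_range.1 ((mem_cells_iff_row lam hN x).1 hx).1

@[to_additive]
theorem prod_cells_row {M : Type*} [CommMonoid M] (hN : lam.colLen 0 ≤ N) (f : ℕ × ℕ → M) :
    ∏ x ∈ lam.cells, f x = ∏ i ∈ range N, ∏ j ∈ range (lam.rowLen i), f (i, j) :=
  prod_finset_product _ _ _ (mem_cells_iff_row lam hN)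

theorem sum_cells_col (f : ℕ × ℕ → ℕ) :
    ∑ x ∈ lam.cells, f x =
      ∑ j ∈ range (lam.rowLen 0), ∑ i ∈ range (lam.colLen j), f (i, j) :=
  sum_finset_product_right _ _ _ (mem_cells_iff_col lam)

theorem sum_fst_cells : ∑ x ∈ lam.cells, x.1 = nStat lam := by
  rw [sum_cells_row lam le_rfl, nStat]
  simp only [sum_const, card_range, smul_eq_mul, mul_comm]

theorem sum_arm_cells : ∑ x ∈ lam.cells, (lam.rowLen x.1 - (x.2 + 1)) = ∑ x ∈ lam.cells, x.2 := by
  rw [sum_cells_row lam le_rfl, sum_cells_row lam le_rfl]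
  refine sum_congr rfl fun i _ => ?_
  simp only [← sum_range_reflect (fun j => j), Nat.sub_sub, add_comm]

theorem sum_leg_cells : ∑ x ∈ lam.cells, (lam.colLen x.2 - (x.1 + 1)) = ∑ x ∈ lam.cells, x.1 := by
  rw [sum_cells_col, sum_cells_col]
  refine sum_congr rfl fun j _ => ?_
  simp only [← sum_range_reflect (fun i => i), Nat.sub_sub, add_comm]

theorem sum_hookLength :
    ∑ x ∈ lam.cells, hookLength lam x = ∑ x ∈ lam.cells, x.2 + nStat lam + lam.card := by
  simp only [hookLength, sum_add_distrib]
  rw [sum_arm_cells, sum_leg_cells, sum_fst_cells, sum_const, smul_eq_mul, mul_one]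

theorem sum_content (hN : lam.colLen 0 ≤ N) :
    ∑ x ∈ lam.cells, (N - x.1 + x.2) + nStat lam = lam.card * N + ∑ x ∈ lam.cells, x.2 := by
  rw [← sum_fst_cells, ← sum_add_distrib, YoungDiagram.card, ← smul_eq_mul, ← sum_const,
    ← sum_add_distrib]
  refine sum_congr rfl fun x hx => ?_
  have hlt := fst_lt_of_mem_cells lam hN hx
  omega

theorem hookLength_pos (x : ℕ × ℕ) : 0 < hookLength lam x := Nat.succ_pos _

theorem content_pos (hN : lam.colLen 0 ≤ N) {x : ℕ × ℕ} (hx : x ∈ lam.cells) :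
    0 < N - x.1 + x.2 :=
  Nat.add_pos_left (Nat.sub_pos_of_lt (fst_lt_of_mem_cells lam hN hx)) _

/-- The row lengths of `lam` in strict coordinates, as the bottom row of a pattern. -/
def bottomRow (N : ℕ) (lam : YoungDiagram) : Fin N → ℤ := fun i => (lam.rowLen i : ℤ) - i

theorem strictAnti_bottomRow : StrictAnti (bottomRow N lam) := fun i j hij => by
  have hrow := lam.rowLen_anti i j hij.le
  have hij : (i : ℕ) < j := hij
  simp only [bottomRow]
  omega

theorem strictMonoOn_toNat_sub {L : Fin N → ℤ} (hL : StrictAnti L) (i : Fin N) :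
    StrictMonoOn (fun k => (L i - L k).toNat) (Set.Ici i) := fun k hk l _ hkl => by
  have hik := hL.antitone hk
  have hkl := hL hkl
  dsimp only
  omega

theorem strictAntiOn_hookLength (i : ℕ) :
    StrictAntiOn (fun j => hookLength lam (i, j)) (Set.Iio (lam.rowLen i)) :=
  fun j _ k hk hjk => by
    have hleg := lam.colLen_anti j k hjk.le
    have hrow : k < lam.rowLen i := hk
    simp only [hookLength]
    omega

theorem hookLength_ne_toNat_sub {i k : Fin N} (hik : i < k) {j : ℕ} (hj : j < lam.rowLen i) :
    hookLength lam (i, j) ≠ (bottomRow N lam i - bottomRow N lam k).toNat := by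
  have hrow := lam.rowLen_anti i k hik.le
  have hcol := (lt_rowLen_iff lam).1 hj
  have hcell := lt_rowLen_iff lam (i := k) (j := j)
  have hik : (i : ℕ) < k := hik
  simp only [hookLength, bottomRow]
  omega

theorem hookLength_mem_Ico (hN : lam.colLen 0 ≤ N) {i j : ℕ} (hj : j < lam.rowLen i) :
    hookLength lam (i, j) ∈ Ico 1 (N - i + lam.rowLen i) := by
  have hcol := (lt_rowLen_iff lam).1 hj
  have hle := (lam.colLen_anti 0 j (Nat.zero_le j)).trans hN
  simp only [hookLength, mem_Ico]
  omega

theorem toNat_bottomRow_sub_mem_Ico {i k : Fin N} (hik : i < k) :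
    (bottomRow N lam i - bottomRow N lam k).toNat ∈ Ico 1 (N - i + lam.rowLen i) := by
  have hrow := lam.rowLen_anti i k hik.le
  have hik : (i : ℕ) < k := hik
  simp only [bottomRow, mem_Ico]
  omega

theorem disjoint_image_hookLength (i : Fin N) :
    Disjoint ((range (lam.rowLen i)).image fun j => hookLength lam (i, j))
      ((Ioi i).image fun k => (bottomRow N lam i - bottomRow N lam k).toNat) := by
  simp only [disjoint_left, mem_image, mem_range, mem_Ioi, not_exists, not_and,
    forall_exists_index, and_imp]
  rintro _ j hj rfl k hk h
  exact hookLength_ne_toNat_sub lam hk hj h.symm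

theorem injOn_hookLength_row (i : ℕ) :
    Set.InjOn (fun j => hookLength lam (i, j)) (range (lam.rowLen i)) := by
  rw [coe_range]
  exact (strictAntiOn_hookLength lam i).injOn

theorem injOn_toNat_sub {L : Fin N → ℤ} (hL : StrictAnti L) (i : Fin N) :
    Set.InjOn (fun k => (L i - L k).toNat) (Ioi i) := by
  rw [coe_Ioi]
  exact (strictMonoOn_toNat_sub hL i).injOn.mono Set.Ioi_subset_Ici_self

theorem image_hookLength_union_image_toNat_sub (hN : lam.colLen 0 ≤ N) (i : Fin N) :
    ((range (lam.rowLen i)).image fun j => hookLength lam (i, j)) ∪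
      ((Ioi i).image fun k => (bottomRow N lam i - bottomRow N lam k).toNat) =
      Ico 1 (N - i + lam.rowLen i) := by
  apply eq_of_subset_of_card_le
  · refine union_subset (image_subset_iff.2 fun j hj => ?_) (image_subset_iff.2 fun k hk => ?_)
    · exact hookLength_mem_Ico lam hN (mem_range.1 hj)
    · exact toNat_bottomRow_sub_mem_Ico lam (mem_Ioi.1 hk)
  · rw [card_union_of_disjoint (disjoint_image_hookLength lam i),
      card_image_of_injOn (injOn_hookLength_row lam i),
      card_image_of_injOn (injOn_toNat_sub (strictAnti_bottomRow lam) i), card_range, Fin.card_Ioi,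
      Nat.card_Ico]
    omega

theorem prod_hookLength_row_mul {M : Type*} [CommMonoid M] (hN : lam.colLen 0 ≤ N) (g : ℕ → M)
    (i : Fin N) :
    (∏ j ∈ range (lam.rowLen i), g (hookLength lam (i, j))) *
      ∏ k ∈ Ioi i, g (bottomRow N lam i - bottomRow N lam k).toNat =
      ∏ m ∈ Ico 1 (N - i + lam.rowLen i), g m := by
  rw [← image_hookLength_union_image_toNat_sub lam hN i,
    prod_union (disjoint_image_hookLength lam i), prod_image (injOn_hookLength_row lam i),
    prod_image (injOn_toNat_sub (strictAnti_bottomRow lam) i)]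

end Diagram

section HookContent

open Finset Polynomial

variable (lam : YoungDiagram) {N : ℕ}

/-- The product `∏ (1 - q ^ (N + c(x)))` over the boxes of a diagram with at most `N` rows, for
which the subtraction is exact. -/
noncomputable def contentPoly (N : ℕ) (lam : YoungDiagram) : ℤ[X] :=
  ∏ x ∈ lam.cells, (1 - X ^ (N - x.1 + x.2))

/-- The product `∏ (1 - q ^ h(x))` over the boxes of a diagram. -/
noncomputable def hookPoly (lam : YoungDiagram) : ℤ[X] :=
  ∏ x ∈ lam.cells, (1 - X ^ hookLength lam x)

theorem gaussCoeff_transpose (N : ℕ) :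
    gaussCoeff N lam.transpose = ∏ x ∈ lam.cells,
      (1 - (RatFunc.X : RatFunc ℤ) ^ ((N : ℤ) + x.2 - x.1)) /
        (1 - (RatFunc.X : RatFunc ℤ) ^ hookLength lam x) := by
  have hhook : ∀ x : ℕ × ℕ, hookLength lam.transpose x = hookLength lam x.swap := fun x => by
    simp only [hookLength, YoungDiagram.rowLen_transpose, YoungDiagram.colLen_transpose,
      Prod.fst_swap, Prod.snd_swap, add_comm]
  have hcontent : ∀ x : ℕ × ℕ, (N : ℤ) - content x = N + x.swap.2 - x.swap.1 := fun x => by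
    rw [content, Prod.fst_swap, Prod.snd_swap]
    ring
  simp only [gaussCoeff, hhook, hcontent]
  exact prod_equiv (Equiv.prodComm ℕ ℕ) (fun x => by simp) fun x _ => rfl

theorem gaussCoeff_transpose_eq_div (hN : lam.colLen 0 ≤ N) :
    gaussCoeff N lam.transpose = algebraMap ℤ[X] (RatFunc ℤ) (contentPoly N lam) /
      algebraMap ℤ[X] (RatFunc ℤ) (hookPoly lam) := by
  rw [gaussCoeff_transpose, contentPoly, hookPoly, map_prod, map_prod, ← prod_div_distrib]
  refine prod_congr rfl fun x hx => ?_
  have hlt := fst_lt_of_mem_cells lam hN hx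
  simp only [map_sub, map_one, map_pow, RatFunc.algebraMap_X]
  rw [show (N : ℤ) + x.2 - x.1 = ((N - x.1 + x.2 : ℕ) : ℤ) by omega, zpow_natCast]

theorem gaussCoeff_transpose_eq_zero (hN : N < lam.colLen 0) :
    gaussCoeff N lam.transpose = 0 := by
  rw [gaussCoeff_transpose]
  refine prod_eq_zero (i := (N, 0)) ?_ (by simp)
  rwa [YoungDiagram.mem_cells, YoungDiagram.mem_iff_lt_colLen]

theorem factorialPoly_eq_prod_Ico (N : ℕ) :
    factorialPoly N = ∏ i : Fin N, ∏ m ∈ Ico 1 (N - i), (1 - X ^ m) := by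
  rw [factorialPoly, ← prod_range_reflect,
    Fin.prod_univ_eq_prod_range (fun i => ∏ m ∈ Ico 1 (N - i), (1 - X ^ m : ℤ[X]))]
  refine prod_congr rfl fun i _ => ?_
  rw [prod_Ico_eq_prod_range, Nat.sub_right_comm]
  simp only [add_comm]

theorem contentPoly_eq_prod_Ico (hN : lam.colLen 0 ≤ N) :
    contentPoly N lam = ∏ i : Fin N, ∏ m ∈ Ico (N - i : ℕ) (N - i + lam.rowLen i), (1 - X ^ m) := by
  rw [contentPoly, prod_cells_row lam hN, ← Fin.prod_univ_eq_prod_range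
    (fun i => ∏ j ∈ range (lam.rowLen i), (1 - X ^ (N - i + j) : ℤ[X]))]
  simp only [prod_Ico_eq_prod_range, Nat.add_sub_cancel_left]

theorem hookPoly_mul_prod_eq (hN : lam.colLen 0 ≤ N) :
    hookPoly lam * ∏ i, ∏ k ∈ Ioi i, (1 - X ^ (bottomRow N lam i - bottomRow N lam k).toNat) =
      contentPoly N lam * factorialPoly N := by
  rw [hookPoly, prod_cells_row lam hN, contentPoly_eq_prod_Ico lam hN, factorialPoly_eq_prod_Ico,
    ← Fin.prod_univ_eq_prod_range
      (fun i => ∏ j ∈ range (lam.rowLen i), (1 - X ^ hookLength lam (i, j) : ℤ[X])),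
    ← prod_mul_distrib, ← prod_mul_distrib]
  refine prod_congr rfl fun i _ => ?_
  rw [prod_hookLength_row_mul lam hN fun m => (1 - X ^ m : ℤ[X]),
    ← prod_Ico_consecutive _ (Nat.sub_pos_of_lt i.2) (Nat.le_add_right _ _), mul_comm]

theorem patternPoly_mul_hookPoly (hN : lam.colLen 0 ≤ N) :
    patternPoly (bottomRow N lam) * hookPoly lam = contentPoly N lam := by
  have hne : factorialPoly N ≠ 0 :=
    prod_ne_zero_iff.2 fun _ _ => prod_one_sub_X_pow_ne_zero fun j _ => Nat.succ_pos j
  apply mul_right_cancel₀ hne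
  rw [← hookPoly_mul_prod_eq lam hN, ← patternPoly_mul_factorialPoly (strictAnti_bottomRow lam)]
  ring

theorem algebraMap_patternPoly_bottomRow (hN : lam.colLen 0 ≤ N) :
    algebraMap ℤ[X] (RatFunc ℤ) (patternPoly (bottomRow N lam)) = gaussCoeff N lam.transpose := by
  have hne : algebraMap ℤ[X] (RatFunc ℤ) (hookPoly lam) ≠ 0 :=
    (FaithfulSMul.algebraMap_eq_zero_iff ℤ[X] (RatFunc ℤ)).not.2
      (prod_one_sub_X_pow_ne_zero fun x _ => hookLength_pos lam x)
  rw [gaussCoeff_transpose_eq_div lam hN, eq_div_iff hne, ← map_mul,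
    patternPoly_mul_hookPoly lam hN]

theorem isSymmetric_patternPoly_bottomRow (hN : lam.colLen 0 ≤ N) :
    IsSymmetric (patternPoly (bottomRow N lam)) :=
  isSymmetric_of_reverse_eq <| reverse_eq_self_of_mul_prod_eq (fun x _ => hookLength_pos lam x)
    (patternPoly_mul_hookPoly lam hN)

theorem patternPoly_bottomRow_ne_zero (hN : lam.colLen 0 ≤ N) :
    patternPoly (bottomRow N lam) ≠ 0 := fun h => by
  have hzero := patternPoly_mul_hookPoly lam hN
  rw [h, zero_mul] at hzero
  exact prod_one_sub_X_pow_ne_zero (fun x hx => content_pos lam hN hx) hzero.symm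

theorem natDegree_patternPoly_bottomRow (hN : lam.colLen 0 ≤ N) :
    ((patternPoly (bottomRow N lam)).natDegree : ℤ) =
      ((N : ℤ) - 1) * (lam.card : ℤ) - 2 * (nStat lam : ℤ) := by
  have hdeg := natDegree_add_sum_eq_of_mul_prod_eq (patternPoly_bottomRow_ne_zero lam hN)
    (fun x _ => hookLength_pos lam x) (fun x hx => content_pos lam hN hx)
    (patternPoly_mul_hookPoly lam hN)
  have hsum := sum_content lam hN
  rw [sum_hookLength] at hdeg
  zify at hdeg hsum
  linarith

end HookContent

end GenGauss

/-- The degree is that of the coefficient itself; the last conjunct gives the degree of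
`q ^ n(lam)` times the coefficient, which is the Schur function at `1, q, …, q ^ (N - 1)`.
If `lam` has more than `N` rows the coefficient is `0` and has no degree. -/
theorem corollary1 (N : ℕ) (lam : YoungDiagram) :
    ∃ P : Polynomial ℤ,
      algebraMap (Polynomial ℤ) (RatFunc ℤ) P = GenGauss.gaussCoeff N lam.transpose ∧
      GenGauss.IsSymmetric P ∧
      GenGauss.IsUnimodal P ∧
      (lam.colLen 0 ≤ N →
        P ≠ 0 ∧
        (P.natDegree : ℤ) = ((N : ℤ) - 1) * (lam.card : ℤ) - 2 * (GenGauss.nStat lam : ℤ) ∧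
        ((Polynomial.X ^ GenGauss.nStat lam * P).natDegree : ℤ) =
          ((N : ℤ) - 1) * (lam.card : ℤ) - (GenGauss.nStat lam : ℤ)) := by
  by_cases hN : lam.colLen 0 ≤ N
  · have hne := GenGauss.patternPoly_bottomRow_ne_zero lam hN
    have hdeg := GenGauss.natDegree_patternPoly_bottomRow lam hN
    refine ⟨GenGauss.patternPoly (GenGauss.bottomRow N lam),
      GenGauss.algebraMap_patternPoly_bottomRow lam hN,
      GenGauss.isSymmetric_patternPoly_bottomRow lam hN,
      GenGauss.isUnimodal_patternPoly _, fun _ => ⟨hne, hdeg, ?_⟩⟩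
    rw [Polynomial.natDegree_X_pow_mul _ hne, Nat.cast_add, hdeg]
    ring
  · refine ⟨0, ?_, fun i _ => by simp, ⟨0, by simp, by simp, by simp⟩, fun h => absurd h hN⟩
    rw [map_zero, GenGauss.gaussCoeff_transpose_eq_zero lam (not_le.1 hN)]
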